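/- Let $p$ be a prime number and let $\mathbb F_p^2$ be the affine plane over the field with $p$ elements. Each line has a direction (slope) in $\mathbb F_p\cup\{\infty\}$: the lines $\{(x,y): y=mx+c\}$ have slope $m\in\mathbb F_p$ and the lines $\{(x,y): x=c\}$ have slope $\infty$. For $U\subseteq\mathbb F_p^2$, a direction $m\in\mathbb F_p\cup\{\infty\}$ is called $U$-special if there is a line $\ell$ with slope $m$ such that $\#(\ell\cap U)\ge \frac{\#U}{p}+1$ or $\#(\ell\cap U)\le \frac{\#U}{p}-1$. Let $U\subseteq\mathbb F_p^2$ with $\#U=np-r$, where $n,r$ are integers with $1\le n\le p$ and $0\le r<p$. If $U$ is not contained in the union of $n$ lines, then there are at least $$\left\lceil\frac{p+n+2-r}{n+1}\right\rceil$$ $U$-special directions. In particular ($n=1$, the Rédei–Szőnyi theorem): if $U\subseteq\mathbb F_p^2$ with $\#U\le p$ is not contained in a line, then there are at least $\left\lceil\frac{\#U+3}{2}\right\rceil$ directions $m\in\mathbb F_p\cup\{\infty\}$ such that some line with slope $m$ passes through two distinct points of $U$. -/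

import Mathlib

/-! Lines, slopes and special directions in the affine plane `F_p × F_p`. -/

namespace GaloisPlane

/-- The affine plane over the field with `p` elements. -/
abbrev Plane (p : ℕ) : Type := ZMod p × ZMod p

/-- The directions (slopes): the elements of the prime field, and `∞` for vertical lines. -/
abbrev Direction (p : ℕ) : Type := OnePoint (ZMod p)

/-- The line of slope `m` with parameter `c`: it is `x = c` if `m = ∞`,
and `y = m x + c` if `m` is an element of the field. -/
def line {p : ℕ} [NeZero p] : Direction p → ZMod p → Finset (Plane p)
  | OnePoint.infty, c => Finset.univ.filter fun v => v.1 = c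
  | OnePoint.some a, c => Finset.univ.filter fun v => v.2 = a * v.1 + c

/-- `ℓ` is a line with slope `m`. -/
def HasSlope {p : ℕ} [NeZero p] (ℓ : Finset (Plane p)) (m : Direction p) : Prop :=
  ∃ c : ZMod p, ℓ = line m c

/-- `ℓ` is a line of the plane. -/
def IsLine {p : ℕ} [NeZero p] (ℓ : Finset (Plane p)) : Prop :=
  ∃ m : Direction p, HasSlope ℓ m

/-- `U` is contained in the union of `n` lines. -/
def CoveredByLines {p : ℕ} [NeZero p] (U : Finset (Plane p)) (n : ℕ) : Prop :=
  ∃ ℓ : Fin n → Finset (Plane p), (∀ i, IsLine (ℓ i)) ∧ ∀ u ∈ U, ∃ i, u ∈ ℓ i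

/-- `ℓ` meets `U` in at least `#U / p + 1` points. -/
def IsRich {p : ℕ} (U ℓ : Finset (Plane p)) : Prop :=
  (U.card : ℚ) / p + 1 ≤ (ℓ ∩ U).card

/-- `ℓ` meets `U` in at most `#U / p - 1` points. -/
def IsPoor {p : ℕ} (U ℓ : Finset (Plane p)) : Prop :=
  ((ℓ ∩ U).card : ℚ) ≤ (U.card : ℚ) / p - 1

/-- The direction `m` is `U`-special: some line with slope `m` is `U`-rich or `U`-poor. -/
def IsSpecial {p : ℕ} [NeZero p] (U : Finset (Plane p)) (m : Direction p) : Prop :=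
  ∃ ℓ : Finset (Plane p), HasSlope ℓ m ∧ (IsRich U ℓ ∨ IsPoor U ℓ)

/-- `U` determines the direction `m`: some line with slope `m` passes through two distinct
points of `U`. -/
def Determines {p : ℕ} [NeZero p] (U : Finset (Plane p)) (m : Direction p) : Prop :=
  ∃ ℓ : Finset (Plane p), HasSlope ℓ m ∧ ∃ u ∈ U, ∃ v ∈ U, u ≠ v ∧ u ∈ ℓ ∧ v ∈ ℓ

end GaloisPlane

/-! Suppose that U has fewer special directions than claimed. A shear and a swap of coordinates send
a finite special slope, if there is one, to infinity. Let S be the set of special slopes that are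
then finite and d = #S. The assumption becomes (n+1)d + r ≤ p, and n lines have to be found that
cover U (`coveredByFinset_of_slopes`).

Let R = ∏ (X - u₂ + u₁Y) be the Rédei polynomial, T = X^p - X, and f the quotient of T^n by R, of
degree r. For a slope y outside S every line contains n-1 or n points, which puts Rf into the ideal
(T, Y-y)^n (`redei_mul_cofactor_mem`). Hence the digits of Rf in base T are M^(n-k) a_k, where M =
∏_{y∉S} (Y-y) and a_k has total degree at most (n-k)d. On X = u₂ - u₁Y the polynomial T becomes
-u₁QM with Q = ∏_{y∈S} (Y-y). So W = Σ a_k Z^k vanishes at X = u₂ - u₁Y, Z = -u₁Q for every u in U.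

It remains to extract lines from W (`coveredByFinset_of_isGraded`). If a line of slope y ∈ S and
intercept x has more than nd points, a degree count makes Z - (X-x)Q/(Y-y) a factor of W; split it
off and induct. If no line is that rich, W becomes Z^n at each y ∈ S (`specialize_eq_X_pow`). A
Newton polygon argument (`pow_dvd_coeff`) then gives Q^(n-k) ∣ a_k, so a_k is a scalar times Q^(n-k)
and the abscissae of U are roots of one polynomial of degree n: U lies on n vertical lines.

The degeneration rests on `sum_fiberOrder_dichotomy`: the points on the lines of slope y force zeros
of total order at least np - r on the restrictions of W at Y = y to a pencil of parallel lines,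
whereas an irreducible polynomial other than the obvious ones has too few, by comparing it with its
derivative through an eliminant. -/

open Polynomial

namespace GaloisPlane

/-! ### Weighted degrees of bivariate polynomials -/

section Weight

variable {A : Type*} [CommRing A]

/-- Every monomial `x ^ i * y ^ j` of `f` (with `y` the outer variable) satisfies `i + d * j ≤ D`. -/
def WeightLE (d D : ℕ) (f : A[X][X]) : Prop :=
  ∀ i j, D < i + d * j → (f.coeff j).coeff i = 0

variable {d D E : ℕ} {f g : A[X][X]}

theorem WeightLE.mono (h : WeightLE d D f) (hDE : D ≤ E) : WeightLE d E f :=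
  fun i j hij => h i j (by omega)

theorem WeightLE.add (hf : WeightLE d D f) (hg : WeightLE d D g) : WeightLE d D (f + g) :=
  fun i j hij => by rw [coeff_add, coeff_add, hf i j hij, hg i j hij, add_zero]

theorem WeightLE.neg (hf : WeightLE d D f) : WeightLE d D (-f) :=
  fun i j hij => by rw [coeff_neg, coeff_neg, hf i j hij, neg_zero]

theorem WeightLE.sub (hf : WeightLE d D f) (hg : WeightLE d D g) : WeightLE d D (f - g) := by
  rw [sub_eq_add_neg]; exact hf.add hg.neg

theorem weightLE_zero : WeightLE d D (0 : A[X][X]) := fun i j _ => by simp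

theorem WeightLE.mul (hf : WeightLE d D f) (hg : WeightLE d E g) :
    WeightLE d (D + E) (f * g) := by
  intro i j hij
  rw [coeff_mul, finsetSum_coeff]
  refine Finset.sum_eq_zero fun a ha => ?_
  rw [coeff_mul]
  refine Finset.sum_eq_zero fun b hb => ?_
  replace ha := Finset.HasAntidiagonal.mem_antidiagonal.1 ha
  replace hb := Finset.HasAntidiagonal.mem_antidiagonal.1 hb
  by_cases h : D < b.1 + d * a.1
  · rw [hf _ _ h, zero_mul]
  · rw [hg b.2 a.2, mul_zero]
    have : d * j = d * a.1 + d * a.2 := by rw [← ha, mul_add]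
    omega

theorem WeightLE.sum {ι : Type*} {s : Finset ι} {f : ι → A[X][X]}
    (h : ∀ i ∈ s, WeightLE d D (f i)) : WeightLE d D (∑ i ∈ s, f i) := by
  classical
  induction s using Finset.induction_on with
  | empty => simpa using weightLE_zero
  | insert a s ha ih =>
    rw [Finset.sum_insert ha]
    exact (h _ (Finset.mem_insert_self _ _)).add (ih fun i hi => h i (Finset.mem_insert_of_mem hi))

theorem weightLE_C {c : A[X]} (hc : c.natDegree ≤ D) : WeightLE d D (C c) := by
  intro i j hij
  rw [coeff_C]
  split_ifs with h
  · subst h; exact coeff_eq_zero_of_natDegree_lt (by omega)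
  · simp

theorem weightLE_one : WeightLE d 0 (1 : A[X][X]) := by
  rw [← C_1]; exact weightLE_C (by simp)

theorem weightLE_X : WeightLE d d (X : A[X][X]) := by
  intro i j hij
  rw [coeff_X]
  split_ifs with h
  · subst h; rw [coeff_one, if_neg (by omega)]
  · simp

theorem WeightLE.pow (hf : WeightLE d D f) (n : ℕ) : WeightLE d (n * D) (f ^ n) := by
  induction n with
  | zero => simpa using weightLE_one
  | succ n ih => rw [pow_succ, add_mul, one_mul]; exact ih.mul hf

theorem WeightLE.prod {ι : Type*} {s : Finset ι} {f : ι → A[X][X]}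
    (h : ∀ i ∈ s, WeightLE d D (f i)) : WeightLE d (s.card * D) (∏ i ∈ s, f i) := by
  classical
  induction s using Finset.induction_on with
  | empty => simpa using weightLE_one
  | insert a s ha ih =>
    rw [Finset.prod_insert ha, Finset.card_insert_of_notMem ha, add_mul, one_mul, add_comm]
    exact (h _ (Finset.mem_insert_self _ _)).mul (ih fun i hi => h i (Finset.mem_insert_of_mem hi))

theorem WeightLE.coeff_eq_zero (hf : WeightLE d D f) {j : ℕ} (hj : D < d * j) :
    f.coeff j = 0 := by
  ext i; rw [hf i j (by omega), coeff_zero]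

theorem WeightLE.natDegree_coeff_le (hf : WeightLE d D f) (j : ℕ) :
    (f.coeff j).natDegree ≤ D - d * j := by
  rw [natDegree_le_iff_coeff_eq_zero]
  exact fun i hi => hf i j (by omega)

theorem weightLE_of_natDegree (h : ∀ j, f.coeff j ≠ 0 → (f.coeff j).natDegree + d * j ≤ D) :
    WeightLE d D f := by
  intro i j hij
  by_cases h0 : f.coeff j = 0
  · simp [h0]
  · exact coeff_eq_zero_of_natDegree_lt (by have := h j h0; omega)

theorem WeightLE.natDegree_add_le (hf : WeightLE d D f) {j : ℕ} (h0 : f.coeff j ≠ 0) :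
    (f.coeff j).natDegree + d * j ≤ D := by
  by_contra! h
  exact h0 (leadingCoeff_eq_zero.1 (hf _ j h))

theorem WeightLE.natDegree_le (hf : WeightLE 1 D f) : f.natDegree ≤ D := by
  rw [natDegree_le_iff_coeff_eq_zero]
  exact fun j hj => hf.coeff_eq_zero (by omega)

/-- Division by a monic polynomial respects weighted degrees. -/
theorem WeightLE.divMod [Nontrivial A] {k : ℕ} (hg : g.Monic) (hgk : g.natDegree = k)
    (hgw : WeightLE d (d * k) g) (hf : WeightLE d D f) :
    WeightLE d (D - d * k) (f /ₘ g) ∧ WeightLE d D (f %ₘ g) := by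
  suffices H : ∀ (m : ℕ) (f : A[X][X]), f.natDegree < m → WeightLE d D f →
      ∃ q r, r + g * q = f ∧ r.degree < g.degree ∧ WeightLE d (D - d * k) q ∧ WeightLE d D r by
    obtain ⟨q, r, h1, h2, h3, h4⟩ := H _ f (Nat.lt_succ_self _) hf
    obtain ⟨rfl, rfl⟩ := div_modByMonic_unique q r hg ⟨h1, h2⟩
    exact ⟨h3, h4⟩
  intro m
  induction m with
  | zero => intro f hf; omega
  | succ m ih =>
    intro f hfm hf
    by_cases hdeg : f.degree < g.degree
    · exact ⟨0, f, by simp, hdeg, weightLE_zero, hf⟩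
    have hf0 : f ≠ 0 := by
      rintro rfl
      exact hdeg (by rw [degree_zero]; exact bot_lt_iff_ne_bot.2 (degree_ne_bot.2 hg.ne_zero))
    have hle : g.degree ≤ f.degree := not_lt.1 hdeg
    have hkn : k ≤ f.natDegree := hgk ▸ natDegree_le_natDegree hle
    set c : A[X][X] := C f.leadingCoeff * X ^ (f.natDegree - g.natDegree) with hc
    have hlc := hf.natDegree_add_le (j := f.natDegree) (leadingCoeff_ne_zero.2 hf0)
    have hmul : d * f.natDegree = d * (f.natDegree - k) + d * k := by
      rw [← mul_add, Nat.sub_add_cancel hkn]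
    have hcw : WeightLE d (D - d * k) c := by
      have h1 : WeightLE d f.leadingCoeff.natDegree (C f.leadingCoeff) := weightLE_C le_rfl
      refine (h1.mul (weightLE_X.pow (f.natDegree - g.natDegree))).mono ?_
      rw [hgk, mul_comm (f.natDegree - k) d]
      change (f.leadingCoeff).natDegree + _ ≤ _ at hlc
      omega
    have hgc : WeightLE d D (g * c) := (hgw.mul hcw).mono (by omega)
    have hlt := div_wf_lemma ⟨hle, hf0⟩ hg
    by_cases hz : f - g * c = 0
    · refine ⟨c, 0, by rw [zero_add]; exact (sub_eq_zero.1 hz).symm, ?_, hcw, weightLE_zero⟩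
      rw [degree_zero]; exact bot_lt_iff_ne_bot.2 (degree_ne_bot.2 hg.ne_zero)
    have hnd := natDegree_lt_natDegree hz hlt
    obtain ⟨q, r, h1, h2, h3, h4⟩ := ih (f - g * c) (by omega) (hf.sub hgc)
    refine ⟨q + c, r, ?_, h2, h3.add hcw, h4⟩
    rw [mul_add, ← add_assoc, h1, sub_add_cancel]

end Weight

/-! ### Weighted degree as the ordinary degree after a substitution. -/

section Weight

variable {A : Type*} [CommRing A] {d D : ℕ}

/-- The substitution `x ↦ s`, `y ↦ t * s ^ d`, with `s` as the outer variable. -/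
noncomputable def weightHom (A : Type*) [CommRing A] (d : ℕ) : A[X][X] →+* A[X][X] :=
  eval₂RingHom (mapRingHom (C : A →+* A[X])) (C X * X ^ d)

theorem coeff_coeff_weightHom (w : A[X][X]) (N j : ℕ) :
    ((weightHom A d w).coeff N).coeff j =
      if d * j ≤ N then (w.coeff j).coeff (N - d * j) else 0 := by
  induction w using Polynomial.induction_on' with
  | add f g hf hg =>
    rw [map_add, coeff_add, coeff_add, hf, hg, coeff_add, coeff_add]
    split_ifs <;> simp
  | monomial n a =>
    have h : weightHom A d (monomial n a) = map C a * C (X ^ n) * X ^ (d * n) := by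
      rw [weightHom, coe_eval₂RingHom, eval₂_monomial, coe_mapRingHom, mul_pow, ← pow_mul, C_pow,
        mul_assoc]
    rw [h, coeff_mul_X_pow']
    by_cases hj : n = j
    · subst hj
      split_ifs
      · rw [coeff_mul_C, coeff_map, coeff_C_mul_X_pow, if_pos rfl, coeff_monomial, if_pos rfl]
      · simp
    · rw [coeff_monomial, if_neg hj]
      split_ifs
      · rw [coeff_mul_C, coeff_map, coeff_C_mul_X_pow, if_neg (Ne.symm hj), coeff_zero]
      · rw [coeff_mul_C, coeff_map, coeff_C_mul_X_pow, if_neg (Ne.symm hj)]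
      all_goals simp

theorem weightLE_iff_natDegree_weightHom {w : A[X][X]} :
    WeightLE d D w ↔ (weightHom A d w).natDegree ≤ D := by
  rw [natDegree_le_iff_coeff_eq_zero]
  constructor
  · intro h N hN
    ext j
    rw [coeff_coeff_weightHom, coeff_zero]
    split_ifs with hj
    · exact h _ _ (by omega)
    · rfl
  · intro h i j hij
    have := coeff_coeff_weightHom (d := d) w (i + d * j) j
    rw [h _ hij, coeff_zero, if_pos (by omega), Nat.add_sub_cancel] at this
    exact this.symm

theorem le_natDegree_weightHom [Nontrivial A] {w : A[X][X]} (hw : w.Monic) :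
    w.natDegree * d ≤ (weightHom A d w).natDegree := by
  refine le_natDegree_of_ne_zero fun h => ?_
  have := coeff_coeff_weightHom (d := d) w (w.natDegree * d) w.natDegree
  rw [h, coeff_zero, if_pos (by rw [mul_comm]), mul_comm, Nat.sub_self, hw.coeff_natDegree,
    coeff_one_zero] at this
  exact zero_ne_one this

/-- A monic factor of a polynomial that is monic in the weighted sense is so itself. -/
theorem WeightLE.of_mul_left [IsDomain A] {f g : A[X][X]} (hf : f.Monic) (hg : g.Monic)
    (h : WeightLE d ((f.natDegree + g.natDegree) * d) (f * g)) :
    WeightLE d (f.natDegree * d) f := by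
  rw [weightLE_iff_natDegree_weightHom] at h ⊢
  have h1 := le_natDegree_weightHom (d := d) hf
  have h2 := le_natDegree_weightHom (d := d) hg
  have inj : Function.Injective (weightHom A d) := by
    rw [injective_iff_map_eq_zero]
    intro w hw
    ext j i
    have := coeff_coeff_weightHom (d := d) w (i + d * j) j
    rw [hw, if_pos (by omega), Nat.add_sub_cancel] at this
    simpa using this.symm
  -- Degrees add over a domain. Each factor has at least the weight of its leading power, and the
  -- bound on the product leaves no slack.
  rw [map_mul, natDegree_mul ((map_ne_zero_iff _ inj).2 hf.ne_zero)
    ((map_ne_zero_iff _ inj).2 hg.ne_zero), add_mul] at h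
  omega

theorem WeightLE.natDegree_eval_le {w : A[X][X]} {s : A[X]} (hw : WeightLE d D w)
    (hs : s.natDegree ≤ d) : (w.eval s).natDegree ≤ D := by
  rw [eval_eq_sum_range]
  refine natDegree_sum_le_of_forall_le _ _ fun j _ => ?_
  by_cases h0 : w.coeff j = 0
  · simp [h0]
  · have h1 := hw.natDegree_add_le h0
    have h2 : (s ^ j).natDegree ≤ j * d :=
      natDegree_pow_le.trans (Nat.mul_le_mul_left _ hs)
    have h3 := natDegree_mul_le (p := w.coeff j) (q := s ^ j)
    rw [mul_comm d j] at h1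
    omega

end Weight

/-! ### Eliminants and counting roots with multiplicity. -/

section Resultant

variable {K : Type*} [Field K]

/-- An eliminant of an irreducible `w` and some `e` of smaller degree. -/
theorem exists_eliminant {w e : K[X][X]} {n d E : ℕ} (hw : w.Monic) (hirr : Irreducible w)
    (hn : w.natDegree = n) (hww : WeightLE d (n * d) w) (he0 : e ≠ 0) (hen : e.natDegree < n)
    (hew : WeightLE d E e) :
    ∃ δ : K[X], δ ≠ 0 ∧ δ.natDegree ≤ n * E ∧
      ∀ s g : K[X], g ∣ w.eval s → g ∣ e.eval s → g ∣ δ := by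
  classical
  have hn0 : 0 < n := by omega
  -- The matrix of multiplication by e modulo w in the basis of powers of the outer variable. Its
  -- determinant is the norm of e.
  set M : Matrix (Fin n) (Fin n) K[X] :=
    Matrix.of fun i j => ((X ^ (j : ℕ) * e) %ₘ w).coeff i with hM
  have hrem : ∀ f : K[X][X], (f %ₘ w).natDegree < n := fun f => by
    rw [← hn]
    exact natDegree_modByMonic_lt f hw (fun h => by rw [h, natDegree_one] at hn; omega)
  refine ⟨M.det, ?_, ?_, ?_⟩
  · intro hdet
    obtain ⟨u, hu0, hu⟩ := Matrix.exists_mulVec_eq_zero_iff.2 hdet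
    set g : K[X][X] := ∑ j : Fin n, C (u j) * X ^ (j : ℕ) with hg
    have hgc : ∀ i : Fin n, g.coeff i = u i := fun i => by
      rw [hg, finsetSum_coeff, Finset.sum_eq_single i]
      · simp
      · intro b _ hb
        rw [coeff_C_mul_X_pow, if_neg fun h => hb (Fin.ext h.symm)]
      · simp
    have hg0 : g ≠ 0 := by
      rintro h
      refine hu0 (funext fun i => ?_)
      rw [← hgc, h, coeff_zero, Pi.zero_apply]
    have hgn : g.natDegree < n := by
      refine lt_of_le_of_lt (natDegree_sum_le_of_forall_le (n := n - 1) _ _ fun j _ => ?_) (by omega)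
      exact (natDegree_C_mul_X_pow_le _ _).trans (by omega)
    have hmod : (g * e) %ₘ w = 0 := by
      have h1 : (g * e) %ₘ w = ∑ j : Fin n, C (u j) * ((X ^ (j : ℕ) * e) %ₘ w) := by
        have h2 : g * e = ∑ j : Fin n, u j • (X ^ (j : ℕ) * e) := by
          rw [hg, Finset.sum_mul]
          exact Finset.sum_congr rfl fun j _ => by rw [smul_eq_C_mul, mul_assoc]
        rw [h2]
        change modByMonicHom w _ = _
        rw [map_sum]
        exact Finset.sum_congr rfl fun j _ => by
          rw [LinearMap.map_smul, smul_eq_C_mul]; rfl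
      ext1 i
      rw [coeff_zero]
      by_cases hi : i < n
      · have := congrFun hu ⟨i, hi⟩
        rw [h1, finsetSum_coeff]
        rw [Matrix.mulVec, dotProduct] at this
        refine Eq.trans (Finset.sum_congr rfl fun j _ => ?_) this
        rw [coeff_C_mul, hM, Matrix.of_apply, mul_comm]
      · exact coeff_eq_zero_of_natDegree_lt (lt_of_lt_of_le (hrem _) (by omega))
    rw [modByMonic_eq_zero_iff_dvd hw] at hmod
    rcases hirr.prime.dvd_or_dvd hmod with h | h
    · exact hw.not_dvd_of_natDegree_lt hg0 (by omega) h
    · exact hw.not_dvd_of_natDegree_lt he0 (by omega) h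
  · rw [Matrix.det_apply]
    refine natDegree_sum_le_of_forall_le _ _ fun σ _ => ?_
    refine (natDegree_smul_le _ _).trans ?_
    by_cases hz : ∃ i, M (σ i) i = 0
    · obtain ⟨i, hi⟩ := hz
      have h0 : ∏ i, M (σ i) i = 0 := Finset.prod_eq_zero (Finset.mem_univ i) hi
      exact (congrArg natDegree h0).trans_le (by simp)
    push Not at hz
    -- The shifts d·σ(i) and d·i cancel when summed over i, which leaves n·E.
    have hent : ∀ i, (M (σ i) i).natDegree + d * (σ i : ℕ) ≤ E + d * (i : ℕ) := fun i => by
      have h1 : WeightLE d (E + d * (i : ℕ)) (X ^ (i : ℕ) * e) := by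
        rw [mul_comm (X ^ (i : ℕ)) e, mul_comm d (i : ℕ)]
        exact hew.mul (weightLE_X.pow _)
      have hdiv := (WeightLE.divMod hw hn (by rw [mul_comm]; exact hww) h1).2
      exact hdiv.natDegree_add_le (hz i)
    have hsum := Finset.sum_le_sum fun i (_ : i ∈ Finset.univ) => hent i
    rw [Finset.sum_add_distrib, Finset.sum_add_distrib, ← Finset.mul_sum, ← Finset.mul_sum,
      Equiv.sum_comp σ (fun i => (i : ℕ))] at hsum
    have h2 := natDegree_prod_le Finset.univ fun i => M (σ i) i
    simp only [Finset.sum_const, Finset.card_univ, Fintype.card_fin, smul_eq_mul] at hsum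
    omega
  · intro s g hgw hge
    set v : Fin n → K[X] := fun i => s ^ (i : ℕ) with hv
    have hvM : ∀ j, g ∣ Matrix.vecMul v M j := fun j => by
      have h1 : Matrix.vecMul v M j = ((X ^ (j : ℕ) * e) %ₘ w).eval s := by
        rw [eval_eq_sum_range' (hrem _), Finset.sum_range, Matrix.vecMul, dotProduct]
        exact Finset.sum_congr rfl fun i _ => by rw [hM, Matrix.of_apply, hv, mul_comm]
      rw [h1, modByMonic_eq_sub_mul_div, eval_sub, eval_mul, eval_mul]
      exact dvd_sub (hge.mul_left _) (hgw.mul_right _)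
    -- The entries of vM are s^j·e(s) modulo w(s), hence multiples of g. The adjugate turns them
    -- into det M times v, and v starts with 1.
    have h3 : Matrix.vecMul (Matrix.vecMul v M) M.adjugate = M.det • v := by
      rw [Matrix.vecMul_vecMul, Matrix.mul_adjugate, Matrix.vecMul_smul, Matrix.vecMul_one]
    have h4 := congrFun h3 ⟨0, hn0⟩
    have h5 : v ⟨0, hn0⟩ = 1 := pow_zero s
    rw [Pi.smul_apply, h5, smul_eq_mul, mul_one] at h4
    rw [← h4, Matrix.vecMul, dotProduct]
    exact Finset.dvd_sum fun i _ => (hvM i).mul_right _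

theorem sum_le_natDegree_of_pow_dvd {ι : Type*} {s : Finset ι} {x : ι → K}
    (hx : Set.InjOn x s) {k : ι → ℕ} {δ : K[X]} (hδ : δ ≠ 0)
    (h : ∀ i ∈ s, (X - C (x i)) ^ k i ∣ δ) : ∑ i ∈ s, k i ≤ δ.natDegree := by
  have h1 : ∏ i ∈ s, (X - C (x i)) ^ k i ∣ δ := by
    refine Finset.prod_dvd_of_coprime ?_ h
    intro i hi j hj hij
    exact (isCoprime_X_sub_C_of_isUnit_sub
      (sub_ne_zero.2 fun h => hij (hx hi hj h)).isUnit).pow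
  have h2 := natDegree_le_of_dvd h1 hδ
  rw [natDegree_prod_of_monic _ _ fun i _ => (monic_X_sub_C _).pow _] at h2
  simpa [natDegree_pow] using h2

end Resultant

/-! ### Total vanishing order along a pencil of parallel lines. -/

section Fiber

variable {p : ℕ} [Fact p.Prime]

/-- The coefficientwise derivative of a bivariate polynomial. -/
noncomputable def coeffDerivative (w : (ZMod p)[X][X]) : (ZMod p)[X][X] :=
  ∑ j ∈ Finset.range (w.natDegree + 1), C (derivative (w.coeff j)) * X ^ j

theorem coeff_coeffDerivative (w : (ZMod p)[X][X]) (j : ℕ) :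
    (coeffDerivative w).coeff j = derivative (w.coeff j) := by
  rw [coeffDerivative, finsetSum_coeff]
  simp only [coeff_C_mul_X_pow]
  rw [Finset.sum_ite_eq]
  split_ifs with h
  · rfl
  · rw [coeff_eq_zero_of_natDegree_lt (by simpa using h), derivative_zero]

theorem eval_C_coeffDerivative (w : (ZMod p)[X][X]) (c : ZMod p) :
    (coeffDerivative w).eval (C c) = derivative (w.eval (C c)) := by
  rw [coeffDerivative, eval_finsetSum, eval_eq_sum_range, derivative_sum]
  refine Finset.sum_congr rfl fun j _ => ?_
  rw [eval_mul, eval_C, eval_pow, eval_X, derivative_mul, ← C_pow, derivative_C, mul_zero,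
    add_zero]

theorem natDegree_eq_zero_of_derivative {f : (ZMod p)[X]} (hf : derivative f = 0)
    (hp : f.natDegree < p) : f.natDegree = 0 := by
  by_contra h0
  obtain ⟨k, hk⟩ := Nat.exists_eq_succ_of_ne_zero h0
  have h1 := congrArg (fun g => g.coeff k) hf
  simp only [coeff_derivative, coeff_zero, mul_eq_zero] at h1
  rcases h1 with h1 | h1
  · rw [← Nat.succ_eq_add_one, ← hk, coeff_natDegree, leadingCoeff_eq_zero] at h1
    exact h0 (by rw [h1, natDegree_zero])
  · have h2 : ((k + 1 : ℕ) : ZMod p) = 0 := by exact_mod_cast h1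
    rw [ZMod.natCast_eq_zero_iff] at h2
    exact absurd (Nat.le_of_dvd (Nat.succ_pos k) h2) (by omega)

/-- The restriction of `w` to the line `y = - μ * x`. -/
noncomputable def fiber (μ : ZMod p) (w : (ZMod p)[X][X]) (x : ZMod p) : (ZMod p)[X] :=
  w.eval (C (-(μ * x)))

/-- The order of vanishing of `fiber μ w x` at `x`, truncated at `p`. -/
noncomputable def fiberOrder (μ : ZMod p) (w : (ZMod p)[X][X]) (x : ZMod p) : ℕ :=
  open Classical in if fiber μ w x = 0 then p else (fiber μ w x).rootMultiplicity x

variable {μ : ZMod p} {d n r : ℕ} {w : (ZMod p)[X][X]}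

theorem fiber_ne_zero (h : ∀ c : ZMod p, ¬ (X - C (C c)) ∣ w) (x : ZMod p) :
    fiber μ w x ≠ 0 := fun h0 => h _ (dvd_iff_isRoot.2 h0)

/-- An order m ≥ 1 at x costs a root of order m-1 of the eliminant of w and its coefficientwise
derivative, of degree at most n(nd-1), and one root of the restriction of w to the line where the
outer variable is -μX, of degree at most nd. The two excluded kinds of factor are those that would
make a fibre or this restriction vanish identically. -/
theorem sum_fiberOrder_of_irreducible (hw : w.Monic) (hirr : Irreducible w) (hn : w.natDegree = n)
    (hd : 1 ≤ d) (hww : WeightLE d (n * d) w) (hp : n * d < p)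
    (hS : ∀ c : ZMod p, ¬ (X - C (C c)) ∣ w) (hT : ¬ (X + C (C μ * X)) ∣ w) :
    ∑ x, fiberOrder μ w x + n ≤ n * ((n + 1) * d) := by
  have hn1 : 1 ≤ n := hn ▸ hw.natDegree_pos_of_not_isUnit hirr.not_isUnit
  have hnd : 1 ≤ n * d := Nat.mul_pos hn1 hd
  have hord : ∀ x, fiberOrder μ w x = (fiber μ w x).rootMultiplicity x := fun x => by
    rw [fiberOrder, if_neg (fiber_ne_zero hS x)]
  have hpow : ∀ x, (X - C x) ^ fiberOrder μ w x ∣ fiber μ w x := fun x => by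
    rw [hord]; exact pow_rootMultiplicity_dvd _ _
  -- Below degree p a zero derivative means a constant, so here every fibre is a nonzero constant.
  by_cases he : coeffDerivative w = 0
  · have h0 : ∀ x, fiberOrder μ w x = 0 := fun x => by
      suffices h : (fiber μ w x).natDegree = 0 by
        rw [hord, eq_C_of_natDegree_eq_zero h, rootMultiplicity_C]
      refine Nat.eq_zero_of_le_zero ?_
      rw [fiber, eval_eq_sum_range]
      refine natDegree_sum_le_of_forall_le _ _ fun j _ => natDegree_mul_le.trans ?_
      have h1 : (w.coeff j).natDegree = 0 := by
        refine natDegree_eq_zero_of_derivative ?_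
          (lt_of_le_of_lt ((hww.natDegree_coeff_le j).trans (Nat.sub_le _ _)) hp)
        rw [← coeff_coeffDerivative, he, coeff_zero]
      rw [h1, ← C_pow, natDegree_C]
    rw [Finset.sum_eq_zero fun x _ => h0 x]
    nlinarith
  have hen : (coeffDerivative w).natDegree < n := by
    refine lt_of_le_of_lt (natDegree_le_iff_coeff_eq_zero.2 fun j (hj : n - 1 < j) => ?_)
      (Nat.sub_lt hn1 one_pos)
    rw [coeff_coeffDerivative]
    rcases eq_or_lt_of_le (show n ≤ j by omega) with h | h
    · rw [← h, ← hn, hw.coeff_natDegree, derivative_one]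
    · rw [coeff_eq_zero_of_natDegree_lt (by omega), derivative_zero]
  have hew : WeightLE d (n * d - 1) (coeffDerivative w) := by
    intro i j hij
    rw [coeff_coeffDerivative, coeff_derivative, hww _ _ (by omega), zero_mul]
  obtain ⟨δ, hδ0, hδn, hδ⟩ := exists_eliminant hw hirr hn hww he hen hew
  have hsum : ∑ x, (fiberOrder μ w x - 1) ≤ δ.natDegree := by
    refine sum_le_natDegree_of_pow_dvd (x := fun x => x) (fun _ _ _ _ h => h) hδ0 fun x _ => ?_
    refine hδ (C (-(μ * x))) _ ((pow_dvd_pow _ (Nat.sub_le _ _)).trans (hpow x)) ?_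
    rw [eval_C_coeffDerivative]
    exact pow_sub_one_dvd_derivative_of_pow_dvd (hpow x)
  set h : (ZMod p)[X] := w.eval (-(C μ * X)) with hh
  have hh0 : h ≠ 0 := fun h0 => hT (by
    rw [show (X + C (C μ * X) : (ZMod p)[X][X]) = X - C (-(C μ * X)) by rw [C_neg, sub_neg_eq_add]]
    exact dvd_iff_isRoot.2 h0)
  have hhd : h.natDegree ≤ n * d := hww.natDegree_eval_le (by
    rw [natDegree_neg]; exact ((natDegree_C_mul_le μ X).trans natDegree_X_le).trans hd)
  have hsupp : ∑ x, min 1 (fiberOrder μ w x) ≤ h.natDegree := by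
    refine sum_le_natDegree_of_pow_dvd (x := fun x => x) (fun _ _ _ _ h => h) hh0 fun x _ => ?_
    rcases Nat.eq_zero_or_pos (fiberOrder μ w x) with h0 | h0
    · rw [h0]; simp
    · rw [min_eq_left h0, pow_one, dvd_iff_isRoot, IsRoot, hh]
      have h1 : IsRoot (fiber μ w x) x := dvd_iff_isRoot.1 ((dvd_pow_self _ h0.ne').trans (hpow x))
      rw [IsRoot, fiber] at h1
      rw [← h1, eval_eq_sum_range (p := w), eval_eq_sum_range (p := w), eval_finsetSum,
        eval_finsetSum]
      exact Finset.sum_congr rfl fun j _ => by simp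
  have hsplit : ∑ x, fiberOrder μ w x =
      ∑ x, (fiberOrder μ w x - 1) + ∑ x, min 1 (fiberOrder μ w x) := by
    rw [← Finset.sum_add_distrib]
    exact Finset.sum_congr rfl fun x _ => by omega
  have h3 : n * (n * d - 1) + n = n * (n * d) := by
    rw [← Nat.mul_succ]; congr 1; omega
  have h4 : n * ((n + 1) * d) = n * (n * d) + n * d := by ring
  omega

theorem fiber_mul (f g : (ZMod p)[X][X]) (x : ZMod p) :
    fiber μ (f * g) x = fiber μ f x * fiber μ g x := eval_mul

theorem fiberOrder_mul_le (f g : (ZMod p)[X][X]) (x : ZMod p) :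
    fiberOrder μ (f * g) x ≤ fiberOrder μ f x + fiberOrder μ g x := by
  unfold fiberOrder
  by_cases hf : fiber μ f x = 0
  · rw [fiber_mul, hf, zero_mul, if_pos rfl]; exact Nat.le_add_right _ _
  by_cases hg : fiber μ g x = 0
  · rw [fiber_mul, hg, mul_zero, if_pos rfl]; exact Nat.le_add_left _ _
  rw [if_neg hf, if_neg hg, fiber_mul, if_neg (mul_ne_zero hf hg),
    rootMultiplicity_mul (mul_ne_zero hf hg)]

theorem fiberOrder_one (x : ZMod p) : fiberOrder μ 1 x = 0 := by
  have h : fiber μ 1 x = 1 := eval_one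
  rw [fiberOrder, h, if_neg one_ne_zero, ← C_1, rootMultiplicity_C]

theorem fiberOrder_X_sub_C_of_ne {c x : ZMod p} (h : -(μ * x) ≠ c) :
    fiberOrder μ (X - C (C c)) x = 0 := by
  have h1 : fiber μ (X - C (C c)) x = C (-(μ * x) - c) := by
    rw [fiber, eval_sub, eval_X, eval_C, C_sub]
  rw [fiberOrder, h1, if_neg (C_ne_zero.2 (sub_ne_zero.2 h)), rootMultiplicity_C]

theorem sum_fiberOrder_X_sub_C (hμ : μ ≠ 0) (c : ZMod p) :
    ∑ x, fiberOrder μ (X - C (C c)) x ≤ p := by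
  rw [Finset.sum_eq_single (-c / μ)]
  · rw [fiberOrder, if_pos]
    rw [fiber, eval_sub, eval_X, eval_C, mul_div_cancel₀ _ hμ, neg_neg, sub_self]
  · intro x _ hx
    refine fiberOrder_X_sub_C_of_ne fun h => hx ?_
    rw [← h]; field_simp
  · simp

theorem sum_fiberOrder_X_add_C (hμ : μ ≠ 0) :
    ∑ x, fiberOrder μ (X + C (C μ * X)) x = p := by
  have h : ∀ x, fiberOrder μ (X + C (C μ * X)) x = 1 := fun x => by
    have h1 : fiber μ (X + C (C μ * X)) x = C μ * (X - C x) := by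
      rw [fiber, eval_add, eval_X, eval_C, C_neg, C_mul]; ring
    have h2 : C μ * (X - C x) ≠ 0 := mul_ne_zero (C_ne_zero.2 hμ) (X_sub_C_ne_zero x)
    rw [fiberOrder, h1, if_neg h2, rootMultiplicity_mul h2, rootMultiplicity_C,
      rootMultiplicity_X_sub_C_self]
  rw [Finset.sum_congr rfl fun x _ => h x]
  simp [ZMod.card]

/-- The dichotomy for the fibres of a monic `w`: the total order of vanishing is at most `n * p`,
and it is less by more than `r` unless `w` is a power of `y + μ x` or has a factor `y - c`. -/
theorem sum_fiberOrder_dichotomy (hμ : μ ≠ 0) (hd : 1 ≤ d) : ∀ (n : ℕ) (w : (ZMod p)[X][X]),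
    w.Monic → w.natDegree = n → WeightLE d (n * d) w → (n + 1) * d + r ≤ p →
    ∑ x, fiberOrder μ w x ≤ n * p ∧
      (w = (X + C (C μ * X)) ^ n ∨ (∃ c : ZMod p, (X - C (C c)) ∣ w) ∨
        ∑ x, fiberOrder μ w x + r < n * p) := by
  intro n
  induction n using Nat.strong_induction_on with
  | _ n ih =>
  intro w hw hn hww hp
  rcases Nat.eq_zero_or_pos n with rfl | hn1
  · have h1 : w = 1 := hw.natDegree_eq_zero.1 hn
    subst h1
    simp [fiberOrder_one]
  by_cases hirr : Irreducible w
  · by_cases hS : ∃ c : ZMod p, (X - C (C c)) ∣ w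
    · refine ⟨?_, Or.inr (Or.inl hS)⟩
      obtain ⟨c, hc⟩ := hS
      have h1 := eq_of_monic_of_associated (monic_X_sub_C _) hw
        ((irreducible_X_sub_C _).associated_of_dvd hirr hc)
      rw [← h1]
      exact (sum_fiberOrder_X_sub_C hμ c).trans (Nat.le_mul_of_pos_left _ hn1)
    by_cases hT : (X + C (C μ * X)) ∣ w
    · have h1 := eq_of_monic_of_associated (monic_X_add_C _) hw
        (Irreducible.associated_of_dvd
          ((monic_X_add_C _).irreducible_of_degree_eq_one (degree_X_add_C _)) hirr hT)
      have h2 : n = 1 := by rw [← hn, ← h1, natDegree_X_add_C]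
      subst h2
      rw [← h1, sum_fiberOrder_X_add_C hμ]
      exact ⟨by omega, Or.inl (by rw [pow_one])⟩
    push Not at hS
    have hnp : n * d < p := by nlinarith
    have h1 := sum_fiberOrder_of_irreducible hw hirr hn hd hww hnp hS hT
    -- The irreducible bound becomes np - nr - n, which is below np - r.
    have h2 : n * ((n + 1) * d) + n * r ≤ n * p := by
      rw [← mul_add]; exact Nat.mul_le_mul_left _ hp
    have h3 : r ≤ n * r := Nat.le_mul_of_pos_left _ hn1
    exact ⟨by omega, Or.inr (Or.inr (by omega))⟩
  · rw [hw.irreducible_iff_natDegree] at hirr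
    push Not at hirr
    obtain ⟨f, g, hf, hg, hfg, hf0, hg0⟩ := hirr (by rintro rfl; simp at hn; omega)
    have hdeg : f.natDegree + g.natDegree = n := by rw [← hf.natDegree_mul hg, hfg, hn]
    have hfw : WeightLE d (f.natDegree * d) f := by
      refine WeightLE.of_mul_left hf hg ?_; rwa [hdeg, hfg]
    have hgw : WeightLE d (g.natDegree * d) g := by
      refine WeightLE.of_mul_left hg hf ?_; rwa [add_comm, hdeg, mul_comm g, hfg]
    have hle : ∀ m, m ≤ n → (m + 1) * d + r ≤ p := fun m hm =>
      (Nat.add_le_add_right (Nat.mul_le_mul_right _ (Nat.succ_le_succ hm)) _).trans hp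
    obtain ⟨f1, f2⟩ := ih _ (by omega) f hf rfl hfw (hle _ (by omega))
    obtain ⟨g1, g2⟩ := ih _ (by omega) g hg rfl hgw (hle _ (by omega))
    have hsum : ∑ x, fiberOrder μ w x ≤ ∑ x, fiberOrder μ f x + ∑ x, fiberOrder μ g x := by
      rw [← Finset.sum_add_distrib, ← hfg]
      exact Finset.sum_le_sum fun x _ => fiberOrder_mul_le f g x
    have hnp : n * p = f.natDegree * p + g.natDegree * p := by rw [← hdeg, add_mul]
    refine ⟨by omega, ?_⟩
    rcases f2 with f2 | ⟨c, hc⟩ | f2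
    · rcases g2 with g2 | ⟨c, hc⟩ | g2
      · left
        rw [← hfg, ← hdeg, pow_add, ← f2, ← g2]
      · exact Or.inr (Or.inl ⟨c, hfg ▸ hc.mul_left f⟩)
      · exact Or.inr (Or.inr (by omega))
    · exact Or.inr (Or.inl ⟨c, hfg ▸ hc.mul_right g⟩)
    · exact Or.inr (Or.inr (by omega))

/-- If the fibres of `w` vanish to orders `m x`, none of them too large, with a large total, then
`w` is a power of `y + μ x`. -/
theorem eq_pow_of_fiber_dvd (hμ : μ ≠ 0) (hd : 1 ≤ d) (hw : w.Monic) (hn : w.natDegree = n)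
    (hww : WeightLE d (n * d) w) (hp : (n + 1) * d + r ≤ p) {m : ZMod p → ℕ}
    (hm : ∀ x, (X - C x) ^ m x ∣ fiber μ w x) (hmd : ∀ x, m x ≤ n * d)
    (hsum : n * p ≤ ∑ x, m x + r) : w = (X + C (C μ * X)) ^ n := by
  have hnd : n * d + r < p := by nlinarith
  have hle : ∀ x, m x ≤ fiberOrder μ w x := fun x => by
    unfold fiberOrder
    split_ifs with h
    · have := hmd x; omega
    · exact (le_rootMultiplicity_iff h).2 (hm x)
  obtain ⟨-, h | ⟨c, hc⟩ | h⟩ := sum_fiberOrder_dichotomy (r := r) hμ hd n w hw hn hww hp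
  · exact h
  -- The factor has a zero fibre only at x₀, where m ≤ nd is used instead; the cofactor accounts for
  -- at most (n-1)p elsewhere. As nd + r < p, the total is too small.
  · exfalso
    obtain ⟨v, hv⟩ := hc
    have hvm : v.Monic := by rw [hv] at hw; exact (monic_X_sub_C _).of_mul_monic_left hw
    have hvn : v.natDegree + 1 = n := by
      rw [← hn, hv, (monic_X_sub_C _).natDegree_mul hvm, natDegree_X_sub_C, add_comm]
    have hvw : WeightLE d (v.natDegree * d) v := by
      refine WeightLE.of_mul_left hvm (monic_X_sub_C (C c)) ?_
      rwa [natDegree_X_sub_C, hvn, mul_comm v, ← hv]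
    have h1 := (sum_fiberOrder_dichotomy (r := r) hμ hd _ v hvm rfl hvw
      (le_trans (Nat.add_le_add_right (Nat.mul_le_mul_right _ (by omega)) _) hp)).1
    set x₀ := -c / μ with hx₀
    have h2 : ∀ x, x ≠ x₀ → m x ≤ fiberOrder μ v x := fun x hx => by
      refine (hle x).trans ?_
      rw [hv]
      refine (fiberOrder_mul_le _ _ _).trans ?_
      rw [fiberOrder_X_sub_C_of_ne, zero_add]
      intro h; refine hx ?_
      rw [hx₀, ← h]; field_simp
    have h3 := Finset.sum_erase_add Finset.univ m (Finset.mem_univ x₀)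
    have h4 : ∑ x ∈ Finset.univ.erase x₀, m x ≤ ∑ x, fiberOrder μ v x :=
      (Finset.sum_le_sum fun x hx => h2 x (Finset.ne_of_mem_erase hx)).trans
        (Finset.sum_le_sum_of_subset (Finset.erase_subset _ _))
    have h5 := hmd x₀
    have h6 : n * p = v.natDegree * p + p := by rw [← hvn, add_mul, one_mul]
    omega
  · have := Finset.sum_le_sum fun x (_ : x ∈ Finset.univ) => hle x
    omega

end Fiber

/-! ### Zeros that collapse under specialization. -/

section Lifting

variable {K : Type*} [Field K]

/-- Roots of the form `a * π ^ g` of a polynomial over `K[π]` collapse to `0` at `π = 0`. -/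
theorem X_pow_card_dvd_map_eval_zero {H : K[X][X]} {g : ℕ} (hg : 0 < g) {s : Finset K}
    (h : ∀ a ∈ s, H.eval (C a * X ^ g) = 0) : X ^ s.card ∣ H.map (evalRingHom 0) := by
  classical
  rcases eq_or_ne H 0 with rfl | h0
  · simp
  have hinj : Function.Injective fun a : K => (C a * X ^ g : K[X]) := fun a b hab =>
    C_injective (mul_right_cancel₀ (pow_ne_zero g X_ne_zero) hab)
  have h1 : ((s.image fun a : K => (C a * X ^ g : K[X])).val.map fun a => X - C a).prod ∣ H := by
    rw [Multiset.prod_X_sub_C_dvd_iff_le_roots h0, Finset.val_le_iff_val_subset]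
    intro t ht
    obtain ⟨a, ha, rfl⟩ := Finset.mem_image.1 ht
    exact (mem_roots h0).2 (h a ha)
  change ∏ t ∈ s.image (fun a : K => (C a * X ^ g : K[X])), (X - C t) ∣ H at h1
  rw [Finset.prod_image fun a _ b _ hab => hinj hab] at h1
  have h2 := Polynomial.map_dvd (evalRingHom (0 : K)) h1
  rw [Polynomial.map_prod] at h2
  refine (dvd_of_eq ?_).trans h2
  rw [← Finset.prod_const]
  exact Finset.prod_congr rfl fun a _ => by
    rw [Polynomial.map_sub, map_X, map_C, coe_evalRingHom, eval_mul, eval_pow, eval_X,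
      zero_pow hg.ne', mul_zero, C_0, sub_zero]

theorem eval_eval_eq_evalEval {A : Type*} [CommRing A] (W : A[X][X]) (g : A[X]) (x : A) :
    (W.eval g).eval x = W.evalEval x (g.eval x) := by
  rw [← eval₂_evalRingHom]
  exact (eval₂_at_apply (evalRingHom x) g).symm

/-- Over K[π] the polynomial W(x - π^e s, -qs) in s has the roots s = aπ^g, which all tend to 0 with
π. The factor 0^e records the limit of the first argument: x - s if e = 0, and x if e > 0. -/
theorem X_pow_card_dvd_of_evalEval {W : K[X][X][X]} {q : K[X]} {e g : ℕ} (hg : 0 < g) {x : K}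
    {s : Finset K}
    (h : ∀ a ∈ s, W.evalEval (C x - C a * X ^ (g + e)) (-(C a * X ^ g * q)) = 0) :
    X ^ s.card ∣ ((W.map (mapRingHom (evalRingHom 0))).map
      (compRingHom (C x - C (0 ^ e) * X))).eval (-(C (q.eval 0) * X)) := by
  set H : K[X][X] := (W.map (compRingHom (C (C x) - C (X ^ e) * X))).eval (-(C q * X)) with hH
  have h1 : ∀ a ∈ s, H.eval (C a * X ^ g) = 0 := fun a ha => by
    rw [← h a ha, hH, eval_map, ← coe_evalRingHom, hom_eval₂, ← eval₂_evalRingHom]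
    congr 1
    · refine Polynomial.ringHom_ext (fun c => by simp) ?_
      simp only [RingHom.comp_apply, coe_evalRingHom, coe_compRingHom_apply, X_comp, eval_sub,
        eval_C, eval_mul, eval_X]
      ring
    · simp only [coe_evalRingHom, eval_neg, eval_mul, eval_C, eval_X]
      ring
  have h2 := X_pow_card_dvd_map_eval_zero hg h1
  refine h2.trans (dvd_of_eq ?_)
  rw [hH, eval_map, ← coe_mapRingHom, hom_eval₂, eval_map, eval₂_map]
  congr 1
  · refine Polynomial.ringHom_ext (fun c => ?_) ?_
    · simp
    · simp
  · simp

end Lifting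

/-! ### Graded polynomials in three variables. -/

section Graded

variable {A : Type*} [CommRing A] {d n : ℕ} {W : A[X][X][X]}

/-- `W` is monic of degree `n`, and has weighted degree at most `n * d` when the outer variable
has weight `d` and the others have weight `1`. -/
structure IsGraded (d n : ℕ) (W : A[X][X][X]) : Prop where
  monic : W.Monic
  natDegree_eq : W.natDegree = n
  weightLE : ∀ k ≤ n, WeightLE 1 ((n - k) * d) (W.coeff k)

theorem IsGraded.weightLE_eval (h : IsGraded d n W) {g : A[X][X]} (hg : WeightLE 1 d g) :
    WeightLE 1 (n * d) (W.eval g) := by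
  rw [eval_eq_sum_range]
  refine WeightLE.sum fun k hk => ?_
  rw [Finset.mem_range, h.natDegree_eq] at hk
  refine ((h.weightLE k (by omega)).mul (hg.pow k)).mono ?_
  rw [← add_mul, Nat.sub_add_cancel (by omega)]

/-- Synthetic division, V_k = W_(k+1) + g·V_(k+1), carries the weight bound down from the leading
coefficient. -/
theorem IsGraded.exists_eq_mul [IsDomain A] (h : IsGraded d (n + 1) W) {g : A[X][X]}
    (hg : WeightLE 1 d g) (h0 : W.eval g = 0) :
    ∃ V : A[X][X][X], IsGraded d n V ∧ W = (X - C g) * V := by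
  have hW : (X - C g) * (W /ₘ (X - C g)) = W := mul_divByMonic_eq_iff_isRoot.2 h0
  set V := W /ₘ (X - C g) with hV
  have hm : V.Monic := (monic_X_sub_C g).of_mul_monic_left (by rw [hW]; exact h.monic)
  have hn : V.natDegree = n := by
    have h1 := h.natDegree_eq
    rw [← hW, (monic_X_sub_C g).natDegree_mul hm, natDegree_X_sub_C] at h1
    omega
  refine ⟨V, ⟨hm, hn, ?_⟩, hW.symm⟩
  suffices H : ∀ j ≤ n, WeightLE 1 (j * d) (V.coeff (n - j)) by
    intro k hk
    have := H (n - k) (by omega)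
    rwa [Nat.sub_sub_self hk] at this
  intro j
  induction j with
  | zero =>
    intro _
    rw [Nat.sub_zero, ← hn, hm.coeff_natDegree]
    exact weightLE_one.mono (by omega)
  | succ j ih =>
    intro hj
    rw [hV, coeff_divByMonic_X_sub_C_rec, ← hV, show n - (j + 1) + 1 = n - j by omega]
    have h1 := h.weightLE (n - j) (by omega)
    rw [show n + 1 - (n - j) = j + 1 by omega] at h1
    exact h1.add ((hg.mul (ih (by omega))).mono (by rw [add_mul, one_mul, add_comm]))

end Graded

/-! ### The limit with the middle variable frozen. -/

section Newton

/-- Since e > 0, the limit is Σ W_k(x)(-q(0))^k s^k, with W_k taken at π = 0. Divisibility by a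
power of s is then read off coefficient by coefficient. -/
theorem coeff_eval_eq_zero_of_evalEval {K : Type*} [Field K] {W : K[X][X][X]} {q : K[X]}
    {e g k : ℕ} (he : 0 < e) (hg : 0 < g) (hq : q.eval 0 ≠ 0) {x : K} {s : Finset K}
    (h : ∀ a ∈ s, W.evalEval (C x - C a * X ^ (g + e)) (-(C a * X ^ g * q)) = 0)
    (hk : k < s.card) : ((W.coeff k).map (evalRingHom 0)).eval x = 0 := by
  have h1 := X_pow_card_dvd_of_evalEval hg h
  rw [X_pow_dvd_iff] at h1
  have h2 := h1 k hk
  rw [zero_pow he.ne', C_0, zero_mul, sub_zero, map_map, eval_map, eval₂_eq_sum_range,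
    finsetSum_coeff] at h2
  have h3 : ∀ j, ((((C x).compRingHom.comp (mapRingHom (evalRingHom 0))) (W.coeff j)) *
      (-(C (q.eval 0) * X)) ^ j).coeff k =
      if k = j then ((W.coeff j).map (evalRingHom 0)).eval x * (-(q.eval 0)) ^ j else 0 := by
    intro j
    have h4 : (((C x).compRingHom.comp (mapRingHom (evalRingHom 0))) (W.coeff j)) *
      (-(C (q.eval 0) * X)) ^ j =
      C (((W.coeff j).map (evalRingHom 0)).eval x * (-(q.eval 0)) ^ j) * X ^ j := by
      rw [RingHom.comp_apply, coe_compRingHom_apply, coe_mapRingHom, comp_C, ← neg_mul, ← C_neg,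
        mul_pow, ← C_pow, ← mul_assoc, ← C_mul]
    rw [h4, coeff_C_mul_X_pow]
  rw [Finset.sum_congr rfl fun j _ => h3 j, Finset.sum_ite_eq] at h2
  split_ifs at h2 with hmem
  · exact (mul_eq_zero.1 h2).resolve_right (pow_ne_zero _ (neg_ne_zero.2 hq))
  · rw [coeff_eq_zero_of_natDegree_lt (by simpa using hmem), Polynomial.map_zero, eval_zero]

end Newton

/-! ### Behaviour of W at a special slope. -/

section Slopes

variable {p : ℕ} [Fact p.Prime]

/-- `W` vanishes along the curve attached to the point `u` of the plane. -/
def Kills (W : (ZMod p)[X][X][X]) (Q : (ZMod p)[X]) (u : Plane p) : Prop :=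
  W.evalEval (C u.2 - C u.1 * X) (-(C u.1 * Q)) = 0

/-- The abscissae of the points of `U` on the line of slope `y` and intercept `x`. -/
def abscissae (U : Finset (Plane p)) (y x : ZMod p) : Finset (ZMod p) :=
  (U.filter fun u => u.2 - y * u.1 = x).image Prod.fst

theorem mem_abscissae {U : Finset (Plane p)} {y x a : ZMod p} :
    a ∈ abscissae U y x ↔ (a, y * a + x) ∈ U := by
  rw [abscissae, Finset.mem_image]
  constructor
  · rintro ⟨⟨b, c⟩, h, rfl⟩
    rw [Finset.mem_filter] at h
    obtain ⟨h1, rfl⟩ := h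
    simpa using h1
  · intro h
    exact ⟨_, Finset.mem_filter.2 ⟨h, by ring⟩, rfl⟩

theorem card_abscissae (U : Finset (Plane p)) (y x : ZMod p) :
    (abscissae U y x).card = (U.filter fun u => u.2 - y * u.1 = x).card := by
  refine Finset.card_image_of_injOn ?_
  rintro ⟨a, b⟩ h ⟨a', b'⟩ h' rfl
  have h1 := (Finset.mem_filter.1 h).2
  have h2 := (Finset.mem_filter.1 h').2
  rw [← h2] at h1
  exact Prod.ext rfl (sub_left_injective h1)

theorem sum_card_abscissae (U : Finset (Plane p)) (y : ZMod p) :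
    ∑ x, (abscissae U y x).card = U.card := by
  rw [Finset.card_eq_sum_card_fiberwise (f := fun u : Plane p => u.2 - y * u.1)
    (t := Finset.univ) (fun _ _ => Finset.mem_coe.2 (Finset.mem_univ _))]
  exact Finset.sum_congr rfl fun x _ => card_abscissae U y x

variable {W : (ZMod p)[X][X][X]} {U : Finset (Plane p)} {Q q : (ZMod p)[X]} {d n r : ℕ}
  {y : ZMod p}

/-- In the local coordinate π = Y - y, the curves of all points on one line of slope y pass through
X = x, Z = 0 at π = 0. -/
theorem evalEval_shift (hQ : Q = (X - C y) * q) (hU : ∀ u ∈ U, Kills W Q u) {x a : ZMod p}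
    (ha : a ∈ abscissae U y x) :
    (W.map (mapRingHom (X + C y).compRingHom)).evalEval (C x - C a * X)
      (-(C a * X * q.comp (X + C y))) = 0 := by
  have h1 := hU _ (mem_abscissae.1 ha)
  rw [Kills] at h1
  have h2 := map_mapRingHom_evalEval (X + C y).compRingHom W
    (C (y * a + x) - C a * X) (-(C a * Q))
  rw [h1, map_zero] at h2
  rw [← h2]
  congr 1
  · simp only [coe_compRingHom_apply, sub_comp, add_comp, C_comp, mul_comp, X_comp, C_add, C_mul]
    ring
  · simp only [coe_compRingHom_apply, hQ, neg_comp, sub_comp, C_comp, mul_comp, X_comp]; ring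

theorem map_shift_eval_zero (W : (ZMod p)[X][X][X]) :
    (W.map (mapRingHom (X + C y).compRingHom)).map (mapRingHom (evalRingHom 0)) =
      W.map (mapRingHom (evalRingHom y)) := by
  rw [map_map]
  congr 1
  refine Polynomial.ringHom_ext (fun c => ?_) (by simp)
  simp [eval_comp]

theorem IsGraded.weightLE_specialize (hW : IsGraded d n W) :
    WeightLE d (n * d) (W.map (mapRingHom (evalRingHom y))) := by
  intro i j hij
  rw [coeff_map, coe_mapRingHom, coeff_map]
  rcases le_or_gt j n with hj | hj
  · rw [(hW.weightLE j hj).coeff_eq_zero, map_zero]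
    have h1 := Nat.mul_le_mul_left d hj
    rw [one_mul, Nat.sub_mul, mul_comm j, mul_comm n]
    rw [mul_comm n] at hij
    omega
  · have h1 : W.coeff j = 0 := coeff_eq_zero_of_natDegree_lt (by rwa [hW.natDegree_eq])
    rw [h1, coeff_zero, map_zero]

/-- If no line of the special slope `y` is rich, then `W` degenerates at `y`. -/
theorem specialize_eq_X_pow (hW : IsGraded d n W) (hQ : Q = (X - C y) * q) (hq : q.eval y ≠ 0)
    (hU : ∀ u ∈ U, Kills W Q u) (hd : 1 ≤ d) (hp : (n + 1) * d + r ≤ p)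
    (hUn : n * p ≤ U.card + r) (hpoor : ∀ x, (abscissae U y x).card ≤ n * d) :
    W.map (mapRingHom (evalRingHom y)) = X ^ n := by
  set w := W.map (mapRingHom (evalRingHom y)) with hw
  set μ := q.eval y with hμ
  have hwm : w.Monic := hW.monic.map _
  have hwn : w.natDegree = n := by rw [hw, hW.monic.natDegree_map, hW.natDegree_eq]
  -- The shear turns the restriction of w to Z = μ(X - x) into the fibre of v at x.
  set v := w.comp (X + C (C μ * X)) with hv
  have hvm : v.Monic := hwm.comp_X_add_C _
  have hvn : v.natDegree = n := by rw [hv, natDegree_comp, natDegree_X_add_C, mul_one, hwn]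
  have hline : WeightLE d d (X + C (C μ * X) : (ZMod p)[X][X]) :=
    weightLE_X.add (weightLE_C (((natDegree_C_mul_le _ _).trans natDegree_X_le).trans hd))
  have hww : WeightLE d (n * d) w := hW.weightLE_specialize
  have hvw : WeightLE d (n * d) v := by
    rw [hv, comp_eq_sum_left, sum_def]
    refine WeightLE.sum fun j hj => ?_
    have h1 := hww.natDegree_add_le (mem_support_iff.1 hj)
    exact ((weightLE_C le_rfl).mul (hline.pow j)).mono (by rw [mul_comm j]; exact h1)
  have hdvd : ∀ x, (X - C x) ^ (abscissae U y x).card ∣ fiber μ v x := fun x => by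
    have h1 := X_pow_card_dvd_of_evalEval (W := W.map (mapRingHom (X + C y).compRingHom))
      (q := q.comp (X + C y)) (e := 0) one_pos (x := x) (s := abscissae U y x) (fun a ha => by
        rw [add_zero, pow_one]; exact evalEval_shift hQ hU ha)
    rw [map_shift_eval_zero, ← hw, pow_zero, C_1, one_mul, eval_comp, eval_add, eval_X, eval_C,
      zero_add, ← hμ] at h1
    have h2 := _root_.map_dvd (C x - X : (ZMod p)[X]).compRingHom h1
    have h3 : (C x - X : (ZMod p)[X]).compRingHom ((w.map (C x - X).compRingHom).eval
        (-(C μ * X))) = fiber μ v x := by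
      rw [eval_map, hom_eval₂, fiber, hv, eval_comp]
      have h4 : ((C x - X : (ZMod p)[X]).compRingHom).comp (C x - X).compRingHom =
          RingHom.id _ := by
        refine Polynomial.ringHom_ext (fun c => by simp) (by simp)
      rw [h4, eval]
      congr 1
      rw [eval_add, eval_X, eval_C]
      simp only [coe_compRingHom_apply, neg_comp, mul_comp, C_comp, X_comp, C_neg, C_mul]
      ring
    rw [h3, map_pow] at h2
    refine (pow_dvd_pow_of_dvd ⟨-1, ?_⟩ _).trans h2
    simp
  have h := eq_pow_of_fiber_dvd hq hd hvm hvn hvw hp hdvd hpoor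
    (by rw [sum_card_abscissae]; exact hUn)
  have h5 : w = v.comp (X - C (C μ * X)) := by
    rw [hv, comp_assoc, add_comp, X_comp, C_comp, sub_add_cancel, comp_X]
  rw [h5, h, pow_comp, add_comp, X_comp, C_comp, sub_add_cancel]

theorem map_evalRingHom_zero_ne_zero {B : (ZMod p)[X][X]} (hB : ¬ C X ∣ B) :
    B.map (evalRingHom 0) ≠ 0 := by
  intro h
  refine hB ((C_dvd_iff_dvd_coeff _ _).2 fun i => ?_)
  have h1 := congrArg (fun f => f.coeff i) h
  simp only [coeff_map, coe_evalRingHom, coeff_zero] at h1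
  rwa [X_dvd_iff, coeff_zero_eq_eval_zero]

/-- The pair (i, e) minimises the ratio of the π-adic order of a coefficient to its distance from
the leading one: the least slope of the Newton polygon. A failure of divisibility at j makes this
slope less than 1. -/
theorem exists_newton_vertex {V : (ZMod p)[X][X][X]} {j : ℕ} (hj : j ≤ n)
    (hj' : ¬ C X ^ j ∣ V.coeff (n - j)) :
    ∃ i e : ℕ, ∃ B : (ZMod p)[X][X], 1 ≤ i ∧ i ≤ n ∧ e < i ∧ ¬ C X ∣ B ∧
      V.coeff (n - i) = C X ^ e * B ∧
      ∀ k, 1 ≤ k → k ≤ n → ∃ b c, e * k ≤ i * b ∧ V.coeff (n - k) = C X ^ b * c := by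
  have hfin : ∀ f : (ZMod p)[X][X], f ≠ 0 → FiniteMultiplicity (C X) f := fun f hf =>
    FiniteMultiplicity.of_prime_left (prime_C_iff.2 prime_X) hf
  have hj0 : 1 ≤ j := Nat.pos_of_ne_zero (by rintro rfl; simp at hj')
  classical
  set I := (Finset.Icc 1 n).filter fun i => V.coeff (n - i) ≠ 0 with hI
  have hjI : j ∈ I := by
    rw [hI, Finset.mem_filter, Finset.mem_Icc]
    exact ⟨⟨hj0, hj⟩, fun h => hj' (by rw [h]; exact dvd_zero _)⟩
  obtain ⟨i, hiI, hmin⟩ := I.exists_min_image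
    (fun i => (multiplicity (C X) (V.coeff (n - i)) : ℚ) / i) ⟨j, hjI⟩
  have hi := hiI
  rw [hI, Finset.mem_filter, Finset.mem_Icc] at hi
  have hjc := (Finset.mem_filter.1 hjI).2
  obtain ⟨B, hB, hB'⟩ := (hfin _ hi.2).exists_eq_pow_mul_and_not_dvd
  have hi0 : (0 : ℚ) < i := by exact_mod_cast hi.1.1
  refine ⟨i, _, B, hi.1.1, hi.1.2, ?_, hB', hB, ?_⟩
  · have h1 := hmin j hjI
    have h2 := (hfin _ hjc).multiplicity_lt_iff_not_dvd.2 hj'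
    have h3 : (multiplicity (C X) (V.coeff (n - j)) : ℚ) / j < 1 := by
      rw [div_lt_one (by exact_mod_cast hj0)]; exact_mod_cast h2
    have h4 := h1.trans_lt h3
    rw [div_lt_one hi0] at h4
    exact_mod_cast h4
  · intro k hk1 hkn
    by_cases h0 : V.coeff (n - k) = 0
    · exact ⟨multiplicity (C X) (V.coeff (n - i)) * k, 0, Nat.le_mul_of_pos_left _ hi.1.1,
        by rw [h0, mul_zero]⟩
    · obtain ⟨c, hc⟩ := pow_multiplicity_dvd (C X) (V.coeff (n - k))
      refine ⟨_, c, ?_, hc⟩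
      have h1 := hmin k (by rw [hI, Finset.mem_filter, Finset.mem_Icc]; exact ⟨⟨hk1, hkn⟩, h0⟩)
      rw [div_le_div_iff₀ hi0 (by exact_mod_cast hk1), mul_comm _ (i : ℚ)] at h1
      exact_mod_cast h1

/-- If `W` degenerates at `y`, then it does so to the highest order. -/
theorem pow_dvd_coeff (hW : IsGraded d n W) (hQ : Q = (X - C y) * q) (hq : q.eval y ≠ 0)
    (hU : ∀ u ∈ U, Kills W Q u) (hd : 1 ≤ d) (hp : (n + 1) * d + r ≤ p)
    (hUn : n * p ≤ U.card + r) (hWy : W.map (mapRingHom (evalRingHom y)) = X ^ n) :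
    ∀ j ≤ n, C ((X - C y) ^ j) ∣ W.coeff (n - j) := by
  set V := W.map (mapRingHom (X + C y).compRingHom) with hV
  have hVW : V.map (mapRingHom (X - C y).compRingHom) = W := by
    rw [hV, map_map, mapRingHom_comp]
    have h4 : ((X - C y : (ZMod p)[X]).compRingHom).comp (X + C y).compRingHom =
        RingHom.id _ := by
      refine Polynomial.ringHom_ext (fun c => by simp) (by simp)
    rw [h4, mapRingHom_id, map_id]
  suffices H : ∀ j ≤ n, C X ^ j ∣ V.coeff (n - j) by
    intro j hj
    have h1 := _root_.map_dvd (mapRingHom (X - C y : (ZMod p)[X]).compRingHom) (H j hj)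
    rw [← coeff_map, hVW, map_pow, coe_mapRingHom, map_C] at h1
    simpa using h1
  intro j hj
  by_contra hjn
  obtain ⟨i, e, B, hi1, hin, hei, hB, hVi, hmin⟩ := exists_newton_vertex hj hjn
  have hVm : V.Monic := hW.monic.map _
  have hVn : V.natDegree = n := by rw [hV, hW.monic.natDegree_map, hW.natDegree_eq]
  -- Were e = 0, the coefficient of index n - i would survive at π = 0, against the degeneration to
  -- Z^n.
  have he : 0 < e := by
    refine Nat.pos_of_ne_zero fun h0 => ?_
    rw [h0, pow_zero, one_mul] at hVi
    refine map_evalRingHom_zero_ne_zero hB ?_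
    have h1 := congrArg (fun f => f.coeff (n - i)) hWy
    simp only [← map_shift_eval_zero (y := y) W, ← hV] at h1
    rw [coeff_map, coeff_X_pow, if_neg (by omega), hVi] at h1
    exact h1
  -- Replacing π by π^i makes the slope e/i an integer, so that Z = π^e Z' can be scaled out; N is
  -- what remains.
  set ρ : (ZMod p)[X] →+* (ZMod p)[X] := (X ^ i).compRingHom with hρ
  have hρX : ρ X = X ^ i := by simp [hρ]
  have hA : ∀ k, ∃ c, k ≤ n → (V.coeff (n - k)).map ρ = C (X ^ (e * k)) * c := by
    intro k
    by_cases hk : k ≤ n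
    swap
    · exact ⟨0, fun h => absurd h hk⟩
    rcases Nat.eq_zero_or_pos k with rfl | hk0
    · exact ⟨(V.coeff (n - 0)).map ρ, fun _ => by simp⟩
    obtain ⟨b, c, hb, hc⟩ := hmin k hk0 hk
    refine ⟨C (X ^ (i * b - e * k)) * c.map ρ, fun _ => ?_⟩
    rw [hc, Polynomial.map_mul, Polynomial.map_pow, map_C, hρX, ← C_pow, ← pow_mul, ← mul_assoc,
      ← C_mul, ← pow_add, Nat.add_sub_cancel' hb]
  choose A hA using hA
  have hA0 : A 0 = 1 := by
    have h1 := hA 0 (Nat.zero_le _)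
    rw [mul_zero, pow_zero, C_1, one_mul, Nat.sub_zero, ← hVn, hVm.coeff_natDegree,
      Polynomial.map_one] at h1
    exact h1.symm
  have hAi : A i = B.map ρ := by
    have h1 := hA i hin
    rw [hVi, Polynomial.map_mul, Polynomial.map_pow, map_C, hρX, ← C_pow, ← pow_mul,
      mul_comm i e] at h1
    exact (mul_left_cancel₀ (C_ne_zero.2 (pow_ne_zero _ X_ne_zero)) h1).symm
  set N : (ZMod p)[X][X][X] := ∑ k ∈ Finset.range (n + 1), C (A (n - k)) * X ^ k with hN
  have hNc : ∀ k ≤ n, N.coeff k = A (n - k) := fun k hk => by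
    rw [hN, finsetSum_coeff]
    simp only [coeff_C_mul_X_pow]
    rw [Finset.sum_ite_eq, if_pos (Finset.mem_range.2 (by omega))]
  have hkill : ∀ x, ∀ a ∈ abscissae U y x,
      N.evalEval (C x - C a * X ^ (i - e + e))
        (-(C a * X ^ (i - e) * ρ (q.comp (X + C y)))) = 0 := by
    intro x a ha
    have h1 := evalEval_shift hQ hU ha
    have h2 := map_mapRingHom_evalEval ρ V (C x - C a * X) (-(C a * X * q.comp (X + C y)))
    rw [← hV] at h1
    rw [h1, map_zero, map_sub, map_neg, map_mul, map_mul, map_mul, hρX] at h2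
    have h3 : ∀ c : ZMod p, ρ (C c) = C c := fun c => by simp [hρ]
    rw [h3, h3] at h2
    rw [Nat.sub_add_cancel hei.le]
    have hpos : (X : (ZMod p)[X]) ^ (e * n) ≠ 0 := pow_ne_zero _ X_ne_zero
    refine (mul_eq_zero.1 (?_ : X ^ (e * n) * _ = 0)).resolve_left hpos
    rw [← h2, evalEval, evalEval, hN, eval_finsetSum, eval_finsetSum, Finset.mul_sum,
      eval_eq_sum_range' (n := n + 1) (lt_of_le_of_lt natDegree_map_le (by omega)),
      eval_finsetSum]
    refine Finset.sum_congr rfl fun k hk => ?_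
    have hk' : k ≤ n := by rw [Finset.mem_range] at hk; omega
    have h4 := hA (n - k) (Nat.sub_le _ _)
    rw [Nat.sub_sub_self hk'] at h4
    rw [coeff_map, coe_mapRingHom, h4]
    simp only [eval_mul, eval_C, eval_pow, eval_X]
    have h5 : X ^ (e * n) = (X : (ZMod p)[X]) ^ (e * (n - k)) * (X ^ e) ^ k := by
      rw [← pow_mul, ← pow_add, ← mul_add, Nat.sub_add_cancel hk']
    have h6 : (X : (ZMod p)[X]) ^ i = X ^ e * X ^ (i - e) := by
      rw [← pow_add]; congr 1; omega
    rw [h5]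
    generalize (A (n - k)).eval (C x - C a * X ^ i) = t
    rw [h6, show -(C a * (X ^ e * X ^ (i - e)) * ρ (q.comp (X + C y))) =
      X ^ e * -(C a * X ^ (i - e) * ρ (q.comp (X + C y))) by ring, mul_pow]
    ring
  have hq0 : (ρ (q.comp (X + C y))).eval 0 ≠ 0 := by
    simpa [hρ, eval_comp, zero_pow (show i ≠ 0 by omega)] using hq
  have hcoef : ∀ x k, k ≤ n → k < (abscissae U y x).card →
      ((A (n - k)).map (evalRingHom 0)).eval x = 0 := fun x k hk hlt => by
    rw [← hNc k hk]
    exact coeff_eval_eq_zero_of_evalEval he (by omega) hq0 (hkill x) hlt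
  set b := B.map (evalRingHom 0) with hb
  have hb0 : b ≠ 0 := map_evalRingHom_zero_ne_zero hB
  have hAb : (A i).map (evalRingHom 0) = b := by
    rw [hAi, map_map, hb]
    congr 1
    refine Polynomial.ringHom_ext (fun c => by simp [hρ]) ?_
    simp [hρ, zero_pow (show i ≠ 0 by omega)]
  have hbd : b.natDegree ≤ i * d := by
    refine natDegree_map_le.trans ?_
    rw [natDegree_le_iff_coeff_eq_zero]
    intro k hk
    have h1 : (V.coeff (n - i)).coeff k = 0 := by
      rw [hV, coeff_map, coe_mapRingHom, coeff_map, (hW.weightLE _ (Nat.sub_le _ _)).coeff_eq_zero,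
        map_zero]
      rw [Nat.sub_sub_self hin]; omega
    rw [hVi, ← C_pow, coeff_C_mul] at h1
    exact (mul_eq_zero.1 h1).resolve_left (pow_ne_zero _ X_ne_zero)
  classical
  -- A line with m points makes all coefficients of N of index below m vanish at x when π = 0. The
  -- leading coefficient 1 gives m ≤ n, and b gives m ≤ n - i away from its roots.
  have hcard : ∀ x, (abscissae U y x).card ≤ (n - i) + i * (if b.eval x = 0 then 1 else 0) := by
    intro x
    split_ifs with h
    · rw [mul_one, Nat.sub_add_cancel hin]
      by_contra! hlt
      have h1 := hcoef x n le_rfl hlt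
      rw [Nat.sub_self, hA0, Polynomial.map_one, eval_one] at h1
      exact one_ne_zero h1
    · rw [mul_zero, add_zero]
      by_contra! hlt
      have h1 := hcoef x (n - i) (Nat.sub_le _ _) hlt
      rw [Nat.sub_sub_self hin, hAb] at h1
      exact h h1
  have hroots : ∑ x, (if b.eval x = 0 then 1 else 0) ≤ b.natDegree := by
    rw [← Finset.card_filter]
    exact card_le_degree_of_subset_roots fun x hx =>
      (mem_roots hb0).2 (Finset.mem_filter.1 hx).2
  have hsum := Finset.sum_le_sum fun x (_ : x ∈ Finset.univ) => hcard x
  rw [sum_card_abscissae, Finset.sum_add_distrib, ← Finset.mul_sum, Finset.sum_const,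
    Finset.card_univ, ZMod.card, smul_eq_mul] at hsum
  have h7 := Nat.mul_le_mul_left i (hroots.trans hbd)
  have h8 : n * p = p * (n - i) + i * p := by
    rw [mul_comm p, ← add_mul, Nat.sub_add_cancel hin]
  -- Summing over x gives np ≤ (n-i)p + i·id + r, which this contradicts because id ≥ 1.
  have h9 : i * (i * d) + i * d + r ≤ i * p := by
    have h10 : i * d + d + r ≤ p :=
      le_trans (by rw [add_mul, one_mul]; have := Nat.mul_le_mul_right d hin; omega) hp
    have h11 := Nat.mul_le_mul_left i h10
    have h12 : r ≤ i * r := Nat.le_mul_of_pos_left _ hi1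
    rw [mul_add, mul_add] at h11
    omega
  have h13 : 1 ≤ i * d := Nat.mul_pos hi1 hd
  omega

end Slopes

/-! ### From W to a covering by lines. -/

section Cover

variable {p : ℕ} [Fact p.Prime]

/-- `U` is covered by a finite set of at most `n` lines. -/
def CoveredByFinset (U : Finset (Plane p)) (n : ℕ) : Prop :=
  ∃ L : Finset (Finset (Plane p)), L.card ≤ n ∧ (∀ ℓ ∈ L, IsLine ℓ) ∧ ∀ u ∈ U, ∃ ℓ ∈ L, u ∈ ℓ

theorem mem_line_coe {y x : ZMod p} {u : Plane p} :
    u ∈ line (y : Direction p) x ↔ u.2 - y * u.1 = x := by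
  change u ∈ Finset.univ.filter (fun v : Plane p => v.2 = y * v.1 + x) ↔ _
  rw [Finset.mem_filter, sub_eq_iff_eq_add, add_comm]
  simp

theorem mem_line_infty {x : ZMod p} {u : Plane p} :
    u ∈ line (OnePoint.infty : Direction p) x ↔ u.1 = x := by
  change u ∈ Finset.univ.filter (fun v : Plane p => v.1 = x) ↔ _
  simp

variable {W : (ZMod p)[X][X][X]} {U : Finset (Plane p)} {Q : (ZMod p)[X]} {d n r : ℕ}

theorem kills_iff_sum (hn : W.natDegree = n) (u : Plane p) :
    Kills W Q u ↔ ∑ k ∈ Finset.range (n + 1),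
      (W.coeff k).eval (C u.2 - C u.1 * X) * (-(C u.1 * Q)) ^ k = 0 := by
  rw [Kills, evalEval, eval_eq_sum_range (p := W), hn, eval_finsetSum]
  simp only [eval_mul, eval_pow, eval_C]

/-- The power of Q exhausts the weight allowed to each coefficient, so only scalars c_k are left. A
killed point satisfies Q^n·P(u₁) = 0 with P = Σ c_k(-z)^k, and lies on a vertical line through a
root of P. -/
theorem coveredByFinset_of_pow_dvd (hW : IsGraded d n W) (hQ : Q.Monic) (hQd : Q.natDegree = d)
    (hU : ∀ u ∈ U, Kills W Q u) (hdvd : ∀ j ≤ n, C (Q ^ j) ∣ W.coeff (n - j)) :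
    CoveredByFinset U n := by
  classical
  have h1 : ∀ k, ∃ c : ZMod p, k ≤ n → W.coeff k = C (C c * Q ^ (n - k)) := by
    intro k
    by_cases hk : k ≤ n
    swap
    · exact ⟨0, fun h => absurd h hk⟩
    obtain ⟨g, hg⟩ := hdvd (n - k) (Nat.sub_le _ _)
    rw [Nat.sub_sub_self hk] at hg
    have hQk : (Q ^ (n - k)).natDegree = (n - k) * d := by rw [natDegree_pow, hQd]
    have hQ0 : Q ^ (n - k) ≠ 0 := (hQ.pow _).ne_zero
    have h2 : ∀ i, g.coeff i ≠ 0 → (g.coeff i).natDegree + i = 0 := fun i hi => by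
      have h3 : (W.coeff k).coeff i = Q ^ (n - k) * g.coeff i := by rw [hg, coeff_C_mul]
      have h4 := (hW.weightLE k hk).natDegree_add_le (j := i) (by
        rw [h3]; exact mul_ne_zero hQ0 hi)
      rw [h3, natDegree_mul hQ0 hi, hQk, one_mul] at h4
      omega
    refine ⟨(g.coeff 0).coeff 0, fun _ => ?_⟩
    have h5 : g = C (g.coeff 0) := by
      refine eq_C_of_natDegree_le_zero (natDegree_le_iff_coeff_eq_zero.2 fun i hi => ?_)
      by_contra h
      have := h2 i h; omega
    have h6 : g.coeff 0 = C ((g.coeff 0).coeff 0) := by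
      refine eq_C_of_natDegree_eq_zero ?_
      by_cases h : g.coeff 0 = 0
      · rw [h, natDegree_zero]
      · exact h2 0 h
    rw [← h6, mul_comm, C_mul, ← h5, hg]
  choose c hc using h1
  have hcn : c n = 1 := by
    have := hc n le_rfl
    rw [Nat.sub_self, pow_zero, mul_one, ← hW.natDegree_eq, hW.monic.coeff_natDegree] at this
    rw [← C_1, ← C_1] at this
    rw [← hW.natDegree_eq]
    exact (C_injective (C_injective this)).symm
  set P : (ZMod p)[X] := ∑ k ∈ Finset.range (n + 1), C (c k * (-1) ^ k) * X ^ k with hP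
  have hPn : P.natDegree ≤ n := natDegree_sum_le_of_forall_le _ _ fun k hk =>
    (natDegree_C_mul_X_pow_le _ _).trans (by rw [Finset.mem_range] at hk; omega)
  have hP0 : P ≠ 0 := by
    intro h
    have h2 := congrArg (fun f => f.coeff n) h
    simp only [hP, finsetSum_coeff, coeff_C_mul_X_pow, coeff_zero] at h2
    rw [Finset.sum_ite_eq, if_pos (Finset.mem_range.2 (Nat.lt_succ_self n)), hcn, one_mul] at h2
    exact pow_ne_zero n (neg_ne_zero.2 one_ne_zero) h2
  refine ⟨P.roots.toFinset.image (line OnePoint.infty), ?_, ?_, ?_⟩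
  · exact Finset.card_image_le.trans ((Multiset.toFinset_card_le _).trans
      ((card_roots' P).trans hPn))
  · intro ℓ hℓ
    obtain ⟨a, -, rfl⟩ := Finset.mem_image.1 hℓ
    exact ⟨_, a, rfl⟩
  · intro u hu
    refine ⟨_, Finset.mem_image_of_mem _ (?_ : u.1 ∈ _), mem_line_infty.2 rfl⟩
    rw [Multiset.mem_toFinset, mem_roots hP0, IsRoot, hP, eval_finsetSum]
    have h2 := (kills_iff_sum hW.natDegree_eq u).1 (hU u hu)
    have h3 : Q ^ n * C (∑ k ∈ Finset.range (n + 1), (C (c k * (-1) ^ k) * X ^ k).eval u.1) = 0 := by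
      rw [← h2, map_sum, Finset.mul_sum]
      refine Finset.sum_congr rfl fun k hk => ?_
      have hk' : k ≤ n := by rw [Finset.mem_range] at hk; omega
      rw [hc k hk', eval_C]
      rw [eval_mul, eval_C, eval_pow, eval_X]
      simp only [C_mul, C_pow, C_neg, C_1]
      rw [neg_pow (C u.1 * Q), mul_pow (C u.1)]
      nth_rewrite 1 [← Nat.sub_add_cancel hk']
      rw [pow_add]
      ring
    exact C_eq_zero.1 ((mul_eq_zero.1 h3).resolve_left (hQ.pow n).ne_zero)

/-- For t = ya + x - aY one has (t-x)q = -aQ, so each point of the line gives a root t; there are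
more roots than the degree nd allows. -/
theorem eval_eq_zero_of_abscissae (hW : IsGraded d n W) {q : (ZMod p)[X]} {y x : ZMod p}
    (hQ : Q = (X - C y) * q) (hqd : q.natDegree + 1 ≤ d)
    (hU : ∀ u ∈ U, Kills W Q u) (hrich : n * d < (abscissae U y x).card) :
    W.eval ((X - C (C x)) * C q) = 0 := by
  classical
  have hg : WeightLE 1 d ((X - C (C x)) * C q) :=
    ((weightLE_X.sub (weightLE_C (by simp))).mul (weightLE_C le_rfl)).mono (by omega)
  have hdeg := (hW.weightLE_eval hg).natDegree_le
  have hinj : Function.Injective fun a : ZMod p => (C (y * a + x) - C a * X : (ZMod p)[X]) := by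
    intro a b hab
    have := congrArg (fun f => f.coeff 1) hab
    simpa using this
  refine eq_zero_of_natDegree_lt_card_of_eval_eq_zero' _
    ((abscissae U y x).image fun a : ZMod p => (C (y * a + x) - C a * X : (ZMod p)[X])) ?_ ?_
  · intro t ht
    obtain ⟨a, ha, rfl⟩ := Finset.mem_image.1 ht
    have h1 := hU _ (mem_abscissae.1 ha)
    rw [Kills] at h1
    rw [eval_eval_eq_evalEval, ← h1]
    congr 1
    rw [eval_mul, eval_sub, eval_X, eval_C, eval_C, hQ, C_add, C_mul]
    ring
  · rw [Finset.card_image_of_injective _ hinj]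
    exact lt_of_le_of_lt hdeg hrich

theorem coveredByFinset_of_isGraded (S : Finset (ZMod p)) : ∀ (n : ℕ) (W : (ZMod p)[X][X][X])
    (U : Finset (Plane p)), IsGraded S.card n W →
    (∀ u ∈ U, Kills W (∏ y ∈ S, (X - C y)) u) → n * p ≤ U.card + r →
    (n + 1) * S.card + r ≤ p → CoveredByFinset U n := by
  classical
  intro n
  have hsplit : ∀ y ∈ S, ∏ y ∈ S, (X - C y) = (X - C y) * ∏ z ∈ S.erase y, (X - C z) :=
    fun y hy => (Finset.mul_prod_erase S (fun y => X - C y) hy).symm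
  have hq0 : ∀ y, (∏ z ∈ S.erase y, (X - C z)).eval y ≠ 0 := fun y => by
    rw [eval_prod, Finset.prod_ne_zero_iff]
    intro z hz
    rw [eval_sub, eval_X, eval_C, sub_ne_zero]
    exact (Finset.ne_of_mem_erase hz).symm
  have hqd : ∀ y ∈ S, (∏ z ∈ S.erase y, (X - C z)).natDegree + 1 = S.card := fun y hy => by
    rw [natDegree_finsetProd_X_sub_C_eq_card, Finset.card_erase_add_one hy]
  induction n with
  | zero =>
    intro W U hW hU _ _
    have h1 : W = 1 := hW.monic.natDegree_eq_zero.1 hW.natDegree_eq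
    refine ⟨∅, by simp, by simp, fun u hu => absurd (hU u hu) ?_⟩
    rw [Kills, h1, evalEval, eval_one, eval_one]
    exact one_ne_zero
  | succ n ih =>
    intro W U hW hU hUn hp
    by_cases hrich : ∃ y ∈ S, ∃ x, (n + 1) * S.card < (abscissae U y x).card
    · obtain ⟨y, hy, x, hx⟩ := hrich
      set q := ∏ z ∈ S.erase y, (X - C z) with hq
      have hg : WeightLE 1 S.card ((X - C (C x)) * C q) :=
        ((weightLE_X.sub (weightLE_C (by simp))).mul (weightLE_C le_rfl)).mono
          (by rw [add_comm]; exact (hqd y hy).le)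
      obtain ⟨V, hV, hWV⟩ := hW.exists_eq_mul hg
        (eval_eq_zero_of_abscissae hW (hsplit y hy) (hqd y hy).le hU hx)
      have hcard := Finset.card_filter_add_card_filter_not (s := U)
        (fun u : Plane p => u.2 - y * u.1 = x)
      rw [← card_abscissae] at hcard
      have hle : (abscissae U y x).card ≤ p := (Finset.card_le_univ _).trans_eq (ZMod.card p)
      obtain ⟨L, hL1, hL2, hL3⟩ := ih V (U.filter fun u => ¬ (u.2 - y * u.1 = x)) hV
        (fun u hu => by
          rw [Finset.mem_filter] at hu
          have h1 := hU u hu.1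
          rw [Kills, hWV, evalEval, eval_mul, eval_mul, mul_eq_zero] at h1
          refine h1.resolve_left fun h2 => hu.2 ?_
          rw [hsplit y hy, eval_sub, eval_X, eval_C, eval_sub, eval_C, eval_mul, eval_sub, eval_X,
            eval_C, eval_C] at h2
          have h3 : q * C (u.2 - y * u.1 - x) = 0 := by
            rw [C_sub, C_sub, C_mul]
            linear_combination -h2
          have h4 : q ≠ 0 := (monic_prod_of_monic _ _ fun z _ => monic_X_sub_C z).ne_zero
          exact sub_eq_zero.1 (C_eq_zero.1 ((mul_eq_zero.1 h3).resolve_left h4)))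
        -- A line has at most p points, so lowering n by one preserves the size condition.
        (by rw [add_mul, one_mul] at hUn; omega)
        (le_trans (Nat.add_le_add_right (Nat.mul_le_mul_right _ (by omega)) _) hp)
      refine ⟨insert (line (y : Direction p) x) L, (Finset.card_insert_le _ _).trans (by omega),
        ?_, ?_⟩
      · intro ℓ hℓ
        rcases Finset.mem_insert.1 hℓ with rfl | h
        · exact ⟨_, x, rfl⟩
        · exact hL2 ℓ h
      · intro u hu
        by_cases h : u.2 - y * u.1 = x
        · exact ⟨_, Finset.mem_insert_self _ _, mem_line_coe.2 h⟩
        · obtain ⟨ℓ, h1, h2⟩ := hL3 u (Finset.mem_filter.2 ⟨hu, h⟩)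
          exact ⟨ℓ, Finset.mem_insert_of_mem h1, h2⟩
    · push Not at hrich
      refine coveredByFinset_of_pow_dvd hW (monic_prod_of_monic _ _ fun z _ => monic_X_sub_C z)
        (natDegree_finsetProd_X_sub_C_eq_card _ _) hU fun j hj => ?_
      rw [C_dvd_iff_dvd_coeff]
      intro i
      rw [← Finset.prod_pow]
      refine Finset.prod_dvd_of_coprime (fun y _ z _ hyz =>
        (isCoprime_X_sub_C_of_isUnit_sub (sub_ne_zero.2 hyz).isUnit).pow) fun y hy => ?_
      have hd : 1 ≤ S.card := Finset.card_pos.2 ⟨y, hy⟩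
      have h1 := specialize_eq_X_pow hW (hsplit y hy) (hq0 y) hU hd hp hUn (hrich y hy)
      have h2 := pow_dvd_coeff hW (hsplit y hy) (hq0 y) hU hd hp hUn h1 j hj
      exact (C_dvd_iff_dvd_coeff _ _).1 h2 i

end Cover

/-! ### Expansions in base T and powers of two-generator ideals. -/

section Digits

variable {A : Type*} [CommRing A]

/-- The `k`-th quotient in the expansion of `P` in base `T`. -/
noncomputable def baseQuot (T P : A[X]) (k : ℕ) : A[X] := (fun f => f /ₘ T)^[k] P

/-- The `k`-th digit of `P` in base `T`. -/
noncomputable def baseDigit (T P : A[X]) (k : ℕ) : A[X] := baseQuot T P k %ₘ T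

variable {T P : A[X]}

theorem baseQuot_succ (k : ℕ) : baseQuot T P (k + 1) = baseQuot T P k /ₘ T :=
  Function.iterate_succ_apply' _ _ _

theorem sum_baseDigit (k : ℕ) :
    P = ∑ j ∈ Finset.range k, T ^ j * baseDigit T P j + T ^ k * baseQuot T P k := by
  induction k with
  | zero => simp [baseQuot]
  | succ k ih =>
    rw [Finset.sum_range_succ, add_assoc, pow_succ, mul_assoc, ← mul_add, baseDigit, baseQuot_succ,
      modByMonic_add_div]
    exact ih

theorem mul_add_C_mul_divByMonic [Nontrivial A] (hT : T.Monic) (f g : A[X]) (c : A) :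
    (T * f + C c * g) /ₘ T = f + C c * (g /ₘ T) := by
  refine (div_modByMonic_unique _ (C c * (g %ₘ T)) hT ⟨?_, ?_⟩).1
  · have := modByMonic_add_div g T
    linear_combination C c * this
  · rw [← smul_eq_C_mul]
    exact lt_of_le_of_lt (degree_smul_le c _) (degree_modByMonic_lt g hT)

/-- Modulo c the polynomial is T^(k+1) f, whose k-th digit is 0. -/
theorem C_dvd_baseDigit [Nontrivial A] (hT : T.Monic) {k : ℕ} {f g : A[X]} {c : A}
    (h : P = T ^ (k + 1) * f + C c * g) : C c ∣ baseDigit T P k := by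
  have H : ∀ j ≤ k, baseQuot T P j = T ^ (k + 1 - j) * f + C c * baseQuot T g j := by
    intro j
    induction j with
    | zero => intro _; exact h
    | succ j ih =>
      intro hj
      rw [baseQuot_succ, ih (by omega), show k + 1 - j = (k + 1 - (j + 1)) + 1 by omega, pow_succ',
        mul_assoc, mul_add_C_mul_divByMonic hT, baseQuot_succ]
  have h1 := H k le_rfl
  rw [Nat.add_sub_cancel_left, pow_one] at h1
  rw [baseDigit, h1]
  refine ⟨baseQuot T g k %ₘ T, ?_⟩
  rw [add_modByMonic, (modByMonic_eq_zero_iff_dvd hT).2 (dvd_mul_right T f), zero_add,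
    ← smul_eq_C_mul, smul_modByMonic, smul_eq_C_mul]

/-- A product of n generators with fewer than a factors T and fewer than b factors v would have at
most n - 1 factors. -/
theorem span_pair_pow_le (T v : A) : ∀ n a b : ℕ, a + b = n + 1 →
    Ideal.span {T, v} ^ n ≤ Ideal.span {T ^ a, v ^ b} := by
  intro n
  induction n with
  | zero =>
    intro a b hab
    have h : a = 0 ∨ b = 0 := by omega
    have h1 : (1 : A) ∈ Ideal.span {T ^ a, v ^ b} := by
      refine Ideal.subset_span ?_
      rcases h with rfl | rfl <;> simp
    rw [(Ideal.eq_top_iff_one _).2 h1]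
    exact le_top
  | succ n ih =>
    intro a b hab
    rcases Nat.eq_zero_or_pos a with rfl | ha
    · rw [(Ideal.eq_top_iff_one (Ideal.span {T ^ 0, v ^ b})).2
        (Ideal.subset_span (by simp))]
      exact le_top
    rcases Nat.eq_zero_or_pos b with rfl | hb
    · rw [(Ideal.eq_top_iff_one (Ideal.span {T ^ a, v ^ 0})).2
        (Ideal.subset_span (by simp))]
      exact le_top
    rw [pow_succ, Ideal.mul_le]
    intro s hs t ht
    obtain ⟨t₁, t₂, rfl⟩ := Ideal.mem_span_pair.1 ht
    obtain ⟨c₁, c₂, h1⟩ := Ideal.mem_span_pair.1 (ih (a - 1) b (by omega) hs)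
    obtain ⟨e₁, e₂, h2⟩ := Ideal.mem_span_pair.1 (ih a (b - 1) (by omega) hs)
    refine Ideal.mem_span_pair.2 ⟨c₁ * t₁ + e₁ * t₂ * v, c₂ * t₁ * T + e₂ * t₂, ?_⟩
    have ha' : T ^ a = T ^ (a - 1) * T := by rw [← pow_succ, Nat.sub_add_cancel ha]
    have hb' : v ^ b = v ^ (b - 1) * v := by rw [← pow_succ, Nat.sub_add_cancel hb]
    rw [ha'] at h2 ⊢
    rw [hb'] at h1 ⊢
    linear_combination (t₁ * T) * h1 + (t₂ * v) * h2

theorem prod_span_pair_le {ι : Type*} (s : Finset ι) (l : ι → A) (v : A) :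
    ∏ i ∈ s, Ideal.span {l i, v} ≤ Ideal.span {∏ i ∈ s, l i, v} := by
  classical
  induction s using Finset.induction_on with
  | empty =>
    rw [Finset.prod_empty, Finset.prod_empty, Ideal.one_eq_top,
      (Ideal.eq_top_iff_one (Ideal.span {1, v})).2 (Ideal.subset_span (by simp))]
  | insert i s hi ih =>
    rw [Finset.prod_insert hi, Finset.prod_insert hi]
    refine (Ideal.mul_mono_right ih).trans (Ideal.mul_le.2 fun x hx y hy => ?_)
    obtain ⟨x₁, x₂, rfl⟩ := Ideal.mem_span_pair.1 hx
    obtain ⟨y₁, y₂, rfl⟩ := Ideal.mem_span_pair.1 hy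
    refine Ideal.mem_span_pair.2
      ⟨x₁ * y₁, x₁ * y₂ * l i + x₂ * y₁ * (∏ i ∈ s, l i) + x₂ * y₂ * v, ?_⟩
    ring

theorem prod_mem_pow_card {ι : Type*} {s : Finset ι} {f : ι → A} {I : Ideal A}
    (h : ∀ i ∈ s, f i ∈ I) : ∏ i ∈ s, f i ∈ I ^ s.card := by
  rw [← Finset.prod_const]
  exact Ideal.prod_mem_prod h

theorem mul_mem_pow_of_le {I : Ideal A} {a b : A} {k n : ℕ} (hk : k ≤ n) (ha : a ∈ I ^ k)
    (hb : b ∈ I ^ (n - k)) : a * b ∈ I ^ n := by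
  rw [← Nat.add_sub_cancel' hk, pow_add]
  exact Ideal.mul_mem_mul ha hb

end Digits

/-! ### The Rédei polynomial and the construction of W. -/

section Redei

variable {p : ℕ} [Fact p.Prime]

theorem prod_X_sub_C_eq (p : ℕ) [Fact p.Prime] :
    ∏ x : ZMod p, (X - C x : (ZMod p)[X]) = X ^ p - X := by
  have hp := (Fact.out : p.Prime).one_lt
  have hm : (X ^ p - X : (ZMod p)[X]).Monic :=
    monic_X_pow_sub (by rw [degree_X]; exact_mod_cast hp)
  refine (eq_of_monic_of_dvd_of_natDegree_le
    (monic_prod_of_monic _ _ fun x _ => monic_X_sub_C x) hm ?_ ?_).symm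
  · refine Finset.prod_dvd_of_coprime (fun x _ y _ hxy =>
      isCoprime_X_sub_C_of_isUnit_sub (sub_ne_zero.2 hxy).isUnit) fun x _ => ?_
    rw [dvd_iff_isRoot, IsRoot, eval_sub, eval_pow, eval_X, ZMod.pow_card, sub_self]
  · rw [natDegree_finsetProd_X_sub_C_eq_card, FiniteField.X_pow_card_sub_X_natDegree_eq _ hp,
      Finset.card_univ, ZMod.card]

/-- The polynomial `X ^ p - X`, written as the product of all `X - x`. -/
noncomputable def fieldPoly (p : ℕ) [Fact p.Prime] : (ZMod p)[X][X] :=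
  ∏ x : ZMod p, (X - C (C x))

theorem fieldPoly_monic : (fieldPoly p).Monic := monic_prod_of_monic _ _ fun _ _ => monic_X_sub_C _

theorem natDegree_fieldPoly : (fieldPoly p).natDegree = p := by
  rw [fieldPoly, natDegree_finsetProd_X_sub_C_eq_card, Finset.card_univ, ZMod.card]

theorem weightLE_fieldPoly : WeightLE 1 p (fieldPoly p) := by
  have h : WeightLE 1 (Finset.univ.card * 1) (fieldPoly p) :=
    WeightLE.prod fun x _ => weightLE_X.sub (weightLE_C (by simp))
  rwa [Finset.card_univ, ZMod.card, mul_one] at h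

theorem eval_fieldPoly (t : (ZMod p)[X]) : (fieldPoly p).eval t = t ^ p - t := by
  have h := congrArg (fun f => (f.map C).eval t) (prod_X_sub_C_eq p)
  simpa [fieldPoly, eval_prod, Polynomial.map_prod] using h

/-- The Rédei polynomial of `U`. -/
noncomputable def redei (U : Finset (Plane p)) : (ZMod p)[X][X] :=
  ∏ u ∈ U, (X - C (C u.2 - C u.1 * X))

variable {U : Finset (Plane p)} {n r : ℕ}

theorem redei_monic : (redei U).Monic := monic_prod_of_monic _ _ fun _ _ => monic_X_sub_C _

theorem natDegree_redei : (redei U).natDegree = U.card :=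
  natDegree_finsetProd_X_sub_C_eq_card _ _

theorem weightLE_redei : WeightLE 1 U.card (redei U) := by
  have h : WeightLE 1 (U.card * 1) (redei U) := WeightLE.prod fun u _ =>
    weightLE_X.sub (weightLE_C ((natDegree_sub_le _ _).trans (by
      rw [natDegree_C, Nat.zero_max]
      exact (natDegree_C_mul_le _ _).trans natDegree_X_le)))
  rwa [mul_one] at h

theorem redei_eq_prod (U : Finset (Plane p)) (y : ZMod p) : redei U =
    ∏ x : ZMod p, ∏ u ∈ U with u.2 - y * u.1 = x, (X - C (C u.2 - C u.1 * X)) :=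
  (Finset.prod_fiberwise U (fun u : Plane p => u.2 - y * u.1) _).symm

theorem prod_fiber_mem_pow (U : Finset (Plane p)) (y x : ZMod p) :
    ∏ u ∈ U with u.2 - y * u.1 = x, (X - C (C u.2 - C u.1 * X)) ∈
      Ideal.span {X - C (C x), (C (X - C y) : (ZMod p)[X][X])} ^ (abscissae U y x).card := by
  rw [card_abscissae]
  refine prod_mem_pow_card fun u hu => Ideal.mem_span_pair.2 ⟨1, C (C u.1), ?_⟩
  rw [← (Finset.mem_filter.1 hu).2]
  simp only [C_sub, C_mul]
  ring

theorem prod_mem_span_pow {v : (ZMod p)[X][X]} {k : ℕ} {G : ZMod p → (ZMod p)[X][X]}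
    (h : ∀ x, G x ∈ Ideal.span {X - C (C x), v} ^ k) :
    ∏ x, G x ∈ Ideal.span {fieldPoly p, v} ^ k := by
  have h1 := Ideal.prod_mem_prod (s := Finset.univ) fun x _ => h x
  rw [Finset.prod_pow] at h1
  exact Ideal.pow_right_mono (prod_span_pair_le _ _ _) k h1

/-- The cofactor that completes the Rédei polynomial to degree `n * p`. -/
noncomputable def cofactor (U : Finset (Plane p)) (n : ℕ) : (ZMod p)[X][X] :=
  fieldPoly p ^ n /ₘ redei U

theorem cofactor_spec (hU : U.card + r = n * p) :
    (cofactor U n).Monic ∧ (cofactor U n).natDegree = r ∧ WeightLE 1 r (cofactor U n) := by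
  have hTn : (fieldPoly p ^ n).natDegree = n * p := by
    rw [fieldPoly_monic.natDegree_pow, natDegree_fieldPoly]
  have hTm : (fieldPoly p ^ n).Monic := fieldPoly_monic.pow n
  refine ⟨?_, ?_, ?_⟩
  · rw [Monic, cofactor, leadingCoeff_divByMonic_of_monic redei_monic]
    · exact hTm
    · rw [degree_eq_natDegree redei_monic.ne_zero, degree_eq_natDegree hTm.ne_zero, hTn,
        natDegree_redei]
      exact_mod_cast (by omega : U.card ≤ n * p)
  · rw [cofactor, natDegree_divByMonic _ redei_monic, hTn, natDegree_redei]; omega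
  · have h := (WeightLE.divMod redei_monic (natDegree_redei (U := U))
      (by rw [one_mul]; exact weightLE_redei) ((weightLE_fieldPoly (p := p)).pow n)).1
    rwa [one_mul, show n * p - U.card = r by omega] at h

/-- Lines with n - 1 points lack one factor, which the cofactor supplies modulo Y - y. The
congruence suffices because the Rédei polynomial alone already lies in the power n - 1. -/
theorem redei_mul_cofactor_mem {y : ZMod p} (hn : 1 ≤ n)
    (hy : ∀ x, n ≤ (abscissae U y x).card + 1 ∧ (abscissae U y x).card ≤ n) :
    redei U * cofactor U n ∈ Ideal.span {fieldPoly p, C (X - C y)} ^ n := by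
  classical
  set J := Ideal.span {fieldPoly p, (C (X - C y) : (ZMod p)[X][X])} with hJ
  set G : ZMod p → (ZMod p)[X][X] :=
    fun x => (X - C (C x)) ^ (n - (abscissae U y x).card) with hG
  have h1 : redei U ∈ J ^ (n - 1) := by
    rw [redei_eq_prod U y]
    refine prod_mem_span_pow fun x => Ideal.pow_le_pow_right ?_ (prod_fiber_mem_pow U y x)
    have := (hy x).1; omega
  have h2 : redei U * ∏ x, G x ∈ J ^ n := by
    rw [redei_eq_prod U y, ← Finset.prod_mul_distrib]
    refine prod_mem_span_pow fun x => ?_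
    refine mul_mem_pow_of_le (hy x).2 (prod_fiber_mem_pow U y x) ?_
    exact Ideal.pow_mem_pow (Ideal.subset_span (by simp)) _
  have h3 : cofactor U n - ∏ x, G x ∈ J := by
    have hev : ∀ x : ZMod p, mapRingHom (evalRingHom y) (X - C (C x)) = X - C x := fun x => by
      rw [coe_mapRingHom, Polynomial.map_sub, map_X, map_C, coe_evalRingHom, eval_C]
    have hR : mapRingHom (evalRingHom y) (redei U) =
        ∏ x : ZMod p, (X - C x) ^ (abscissae U y x).card := by
      rw [redei_eq_prod U y, map_prod]
      refine Finset.prod_congr rfl fun x _ => ?_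
      rw [card_abscissae, ← Finset.prod_const, map_prod]
      refine Finset.prod_congr rfl fun u hu => ?_
      rw [← (Finset.mem_filter.1 hu).2, coe_mapRingHom, Polynomial.map_sub, map_X, map_C,
        coe_evalRingHom, eval_sub, eval_mul, eval_C, eval_C, eval_X, mul_comm y]
    have hT : mapRingHom (evalRingHom y) (fieldPoly p ^ n) =
        mapRingHom (evalRingHom y) (redei U) * ∏ x : ZMod p, mapRingHom (evalRingHom y) (G x) := by
      rw [hR, ← Finset.prod_mul_distrib, map_pow, fieldPoly, map_prod, ← Finset.prod_pow]
      refine Finset.prod_congr rfl fun x _ => ?_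
      rw [hG, map_pow, hev, ← pow_add, Nat.add_sub_cancel' (hy x).2]
    have hc : mapRingHom (evalRingHom y) (cofactor U n - ∏ x, G x) = 0 := by
      rw [map_sub, map_prod, cofactor, coe_mapRingHom, map_divByMonic _ redei_monic,
        ← coe_mapRingHom, hT]
      exact sub_eq_zero.2 (mul_divByMonic_cancel_left _ (redei_monic.map _))
    refine Ideal.mem_of_dvd _ ?_ (Ideal.subset_span (Set.mem_insert_of_mem _ rfl) :
      C (X - C y) ∈ J)
    rw [C_dvd_iff_dvd_coeff]
    intro i
    rw [dvd_iff_isRoot]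
    have h4 := congrArg (fun f => f.coeff i) hc
    rwa [coe_mapRingHom, coeff_map, coeff_zero] at h4
  have h4 : redei U * cofactor U n =
      redei U * ∏ x, G x + redei U * (cofactor U n - ∏ x, G x) := by ring
  rw [h4]
  refine Ideal.add_mem _ h2 ?_
  refine mul_mem_pow_of_le (Nat.sub_le n 1) h1 ?_
  rwa [Nat.sub_sub_self hn, pow_one]

/-- If all slopes outside `S` are equidistributed then `U` is covered by `n` lines, as long as `S`
is small. -/
theorem coveredByFinset_of_slopes (S : Finset (ZMod p)) (hn : 1 ≤ n) (hU : U.card + r = n * p)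
    (hS : ∀ y ∉ S, ∀ x, n ≤ (abscissae U y x).card + 1 ∧ (abscissae U y x).card ≤ n)
    (hp : (n + 1) * S.card + r ≤ p) : CoveredByFinset U n := by
  classical
  set P := redei U * cofactor U n with hP
  set Q : (ZMod p)[X] := ∏ y ∈ S, (X - C y) with hQ
  set M : (ZMod p)[X] := ∏ y ∈ Sᶜ, (X - C y) with hM
  obtain ⟨fm, fd, fw⟩ := cofactor_spec hU
  have hPm : P.Monic := redei_monic.mul fm
  have hPd : P.natDegree = n * p := by rw [hP, redei_monic.natDegree_mul fm, natDegree_redei, fd, hU]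
  have hPw : WeightLE 1 (n * p) P := by rw [← hU]; exact weightLE_redei.mul fw
  have hMQ : M * Q = X ^ p - X := by
    rw [hM, hQ, ← prod_X_sub_C_eq p, mul_comm]
    exact Finset.prod_mul_prod_compl S _
  have hMm : M.Monic := monic_prod_of_monic _ _ fun _ _ => monic_X_sub_C _
  have hMd : M.natDegree + S.card = p := by
    rw [hM, natDegree_finsetProd_X_sub_C_eq_card, Finset.card_compl, ZMod.card]
    have := Finset.card_le_univ S
    rw [ZMod.card] at this
    omega
  have hp0 : 0 < p := (Fact.out : p.Prime).pos
  have hTw : WeightLE 1 (1 * p) (fieldPoly p) := by rw [one_mul]; exact weightLE_fieldPoly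
  have hquot : ∀ k ≤ n, (baseQuot (fieldPoly p) P k).Monic ∧
      (baseQuot (fieldPoly p) P k).natDegree = (n - k) * p ∧
      WeightLE 1 ((n - k) * p) (baseQuot (fieldPoly p) P k) := by
    intro k
    induction k with
    | zero => intro _; exact ⟨hPm, hPd, hPw⟩
    | succ k ih =>
      intro hk
      obtain ⟨h1, h2, h3⟩ := ih (by omega)
      have h4 : (n - k) * p = (n - (k + 1)) * p + p := by
        rw [← Nat.succ_mul]; congr 1; omega
      rw [baseQuot_succ]
      refine ⟨?_, ?_, ?_⟩
      · rw [Monic, leadingCoeff_divByMonic_of_monic fieldPoly_monic]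
        · exact h1
        · rw [degree_eq_natDegree fieldPoly_monic.ne_zero, degree_eq_natDegree h1.ne_zero, h2,
            natDegree_fieldPoly]
          exact_mod_cast (by omega : p ≤ (n - k) * p)
      · rw [natDegree_divByMonic _ fieldPoly_monic, h2, natDegree_fieldPoly]; omega
      · have h5 := (WeightLE.divMod fieldPoly_monic natDegree_fieldPoly hTw h3).1
        rwa [one_mul, h4, Nat.add_sub_cancel] at h5
  have hqn : baseQuot (fieldPoly p) P n = 1 := by
    obtain ⟨h1, h2, -⟩ := hquot n le_rfl
    exact h1.natDegree_eq_zero.1 (by rw [h2, Nat.sub_self, zero_mul])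
  have hdvd : ∀ k ≤ n, C (M ^ (n - k)) ∣ baseDigit (fieldPoly p) P k := by
    intro k hk
    rw [C_dvd_iff_dvd_coeff]
    intro i
    rw [hM, ← Finset.prod_pow]
    refine Finset.prod_dvd_of_coprime (fun y _ z _ hyz =>
      (isCoprime_X_sub_C_of_isUnit_sub (sub_ne_zero.2 hyz).isUnit).pow) fun y hy => ?_
    have h1 := redei_mul_cofactor_mem hn (hS y (Finset.mem_compl.1 hy))
    have h2 := span_pair_pow_le (fieldPoly p) (C (X - C y)) n (k + 1) (n - k) (by omega) h1
    obtain ⟨f, g, h3⟩ := Ideal.mem_span_pair.1 h2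
    refine (C_dvd_iff_dvd_coeff _ _).1 (C_dvd_baseDigit fieldPoly_monic (f := f) (g := g) ?_) i
    rw [hP, ← h3, C_pow]; ring
  have hex : ∀ k, ∃ a, k ≤ n → baseDigit (fieldPoly p) P k = C (M ^ (n - k)) * a := fun k => by
    by_cases hk : k ≤ n
    · obtain ⟨a, ha⟩ := hdvd k hk
      exact ⟨a, fun _ => ha⟩
    · exact ⟨0, fun h => absurd h hk⟩
  choose a ha using hex
  have han : a n = 1 := by
    have h1 := ha n le_rfl
    rw [Nat.sub_self, pow_zero, C_1, one_mul, baseDigit, hqn] at h1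
    rw [← h1, modByMonic_eq_self_iff fieldPoly_monic, degree_one,
      degree_eq_natDegree fieldPoly_monic.ne_zero, natDegree_fieldPoly]
    exact_mod_cast hp0
  set W : (ZMod p)[X][X][X] := ∑ k ∈ Finset.range (n + 1), C (a k) * X ^ k with hW
  have hWc : ∀ k, W.coeff k = if k ∈ Finset.range (n + 1) then a k else 0 := fun k => by
    rw [hW, finsetSum_coeff]
    simp only [coeff_C_mul_X_pow]
    rw [Finset.sum_ite_eq]
  have hWle : W.natDegree ≤ n := natDegree_sum_le_of_forall_le _ _ fun k hk =>
    (natDegree_C_mul_X_pow_le _ _).trans (by rw [Finset.mem_range] at hk; omega)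
  have hWn : W.coeff n = 1 := by rw [hWc, if_pos (Finset.mem_range.2 (Nat.lt_succ_self n)), han]
  have hWd : W.natDegree = n := le_antisymm hWle
    (le_natDegree_of_ne_zero (by rw [hWn]; exact one_ne_zero))
  -- The k-th digit has weight at most (n-k)p, of which M^(n-k) takes (n-k)(p-d).
  have hgr : IsGraded S.card n W := by
    refine ⟨monic_of_natDegree_le_of_coeff_eq_one n hWle hWn, hWd, fun k hk => ?_⟩
    rw [hWc, if_pos (Finset.mem_range.2 (by omega))]
    refine weightLE_of_natDegree fun i hi => ?_
    have h1 := (WeightLE.divMod fieldPoly_monic natDegree_fieldPoly hTw (hquot k hk).2.2).2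
    have h2 : (baseDigit (fieldPoly p) P k).coeff i = M ^ (n - k) * (a k).coeff i := by
      rw [ha k hk, coeff_C_mul]
    have hMk : M ^ (n - k) ≠ 0 := (hMm.pow _).ne_zero
    have h3 := h1.natDegree_add_le (j := i) (by
      change (baseDigit (fieldPoly p) P k).coeff i ≠ 0
      rw [h2]; exact mul_ne_zero hMk hi)
    change ((baseDigit (fieldPoly p) P k).coeff i).natDegree + 1 * i ≤ _ at h3
    have h4 : (n - k) * M.natDegree + (n - k) * S.card = (n - k) * p := by rw [← mul_add, hMd]
    rw [h2, natDegree_mul hMk hi, natDegree_pow] at h3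
    omega
  refine coveredByFinset_of_isGraded (r := r) S n W U hgr (fun u hu => ?_) (by omega) hp
  rw [kills_iff_sum hWd]
  set t : (ZMod p)[X] := C u.2 - C u.1 * X with ht
  have hPt : P.eval t = 0 := by
    rw [hP, eval_mul, redei, eval_prod, Finset.prod_eq_zero hu, zero_mul]
    rw [eval_sub, eval_X, eval_C, ← ht, sub_self]
  -- By Frobenius, t^p - t = -u₁(Y^p - Y), and Y^p - Y = MQ. Hence M^n factors out of the whole
  -- expansion.
  have hTt : (fieldPoly p).eval t = -(C u.1 * Q) * M := by
    rw [eval_fieldPoly, ht, sub_pow_char, mul_pow, ← C_pow, ← C_pow, ZMod.pow_card, ZMod.pow_card]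
    linear_combination C u.1 * hMQ
  have hPs := sum_baseDigit (T := fieldPoly p) (P := P) (n + 1)
  rw [baseQuot_succ, hqn, (divByMonic_eq_zero_iff fieldPoly_monic).2 (by
    rw [degree_one, degree_eq_natDegree fieldPoly_monic.ne_zero, natDegree_fieldPoly]
    exact_mod_cast hp0), mul_zero, add_zero] at hPs
  rw [hPs, eval_finsetSum] at hPt
  refine (mul_eq_zero.1 (?_ : M ^ n * _ = 0)).resolve_left (hMm.pow n).ne_zero
  rw [← hPt, Finset.mul_sum]
  refine Finset.sum_congr rfl fun k hk => ?_
  have hk' : k ≤ n := by rw [Finset.mem_range] at hk; omega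
  rw [hWc, if_pos hk, ha k hk', eval_mul, eval_mul, eval_pow, hTt, eval_C, mul_pow]
  nth_rewrite 1 [← Nat.sub_add_cancel hk']
  rw [pow_add]
  ring

end Redei

/-! ### Special directions and the change of coordinates. -/

section Directions

variable {p : ℕ} [Fact p.Prime] {U : Finset (Plane p)} {n r : ℕ}

/-- The intercept of the line of slope `m` through a point. -/
def intercept (m : Direction p) (u : Plane p) : ZMod p :=
  match m with
  | OnePoint.infty => u.1
  | OnePoint.some y => u.2 - y * u.1

theorem mem_line_iff {m : Direction p} {c : ZMod p} {u : Plane p} :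
    u ∈ line m c ↔ intercept m u = c := by
  induction m using OnePoint.rec with
  | infty => exact mem_line_infty
  | coe y => exact mem_line_coe

theorem card_line_inter (m : Direction p) (c : ZMod p) :
    (line m c ∩ U).card = (U.filter fun u => intercept m u = c).card := by
  congr 1
  ext u
  rw [Finset.mem_inter, Finset.mem_filter, mem_line_iff, and_comm]

/-- As #U/p lies in (n-1, n], an integer strictly within 1 of it is n-1 or n. -/
theorem card_bounds_of_not_isSpecial (hU : U.card + r = n * p) (hr : r < p) {m : Direction p}
    (hm : ¬ IsSpecial U m) (c : ZMod p) :
    n ≤ (U.filter fun u => intercept m u = c).card + 1 ∧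
      (U.filter fun u => intercept m u = c).card ≤ n := by
  have hp : (0 : ℚ) < p := by exact_mod_cast (Fact.out : p.Prime).pos
  have h1 : ¬ IsRich U (line m c) := fun h => hm ⟨_, ⟨c, rfl⟩, Or.inl h⟩
  have h2 : ¬ IsPoor U (line m c) := fun h => hm ⟨_, ⟨c, rfl⟩, Or.inr h⟩
  rw [IsRich, card_line_inter, not_le] at h1
  rw [IsPoor, card_line_inter, not_le] at h2
  set k := (U.filter fun u => intercept m u = c).card
  have h3 : (U.card : ℚ) / p * p = U.card := div_mul_cancel₀ _ hp.ne'
  have h4 := mul_lt_mul_of_pos_right h1 hp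
  have h5 := mul_lt_mul_of_pos_right h2 hp
  rw [add_mul, h3, one_mul] at h4
  rw [sub_mul, h3, one_mul, sub_lt_iff_lt_add] at h5
  have h4' : k * p < U.card + p := by exact_mod_cast h4
  have h5' : U.card < k * p + p := by exact_mod_cast h5
  constructor
  · have h6 : n * p < (k + 2) * p := by rw [add_mul, two_mul]; omega
    have := lt_of_mul_lt_mul_right h6 (Nat.zero_le p)
    omega
  · have h6 : k * p < (n + 1) * p := by rw [add_mul, one_mul]; omega
    have := lt_of_mul_lt_mul_right h6 (Nat.zero_le p)
    omega

/-- An affine transformation that moves the slope `y₀` to infinity. -/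
def toInfinity (y₀ : ZMod p) : Plane p ≃ Plane p where
  toFun u := (u.2 - y₀ * u.1, u.1)
  invFun u := (u.2, u.1 + y₀ * u.2)
  left_inv u := by ext <;> simp
  right_inv u := by ext <;> simp

/-- The direction that `toInfinity y₀` moves to the finite slope `y`. -/
def finiteSlope (y₀ y : ZMod p) : Direction p :=
  if y = 0 then OnePoint.infty else ((y₀ + y⁻¹ : ZMod p) : Direction p)

theorem finiteSlope_injective (y₀ : ZMod p) : Function.Injective (finiteSlope y₀) := by
  intro y z h
  unfold finiteSlope at h
  split_ifs at h with h1 h2 h2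
  · rw [h1, h2]
  · exact absurd h (OnePoint.infty_ne_coe _)
  · exact absurd h (OnePoint.coe_ne_infty _)
  · exact inv_injective (add_left_cancel (OnePoint.coe_injective h))

theorem finiteSlope_ne (y₀ y : ZMod p) : finiteSlope y₀ y ≠ (y₀ : Direction p) := by
  unfold finiteSlope
  split_ifs with h
  · exact OnePoint.infty_ne_coe _
  · intro h1
    have := OnePoint.coe_injective h1
    rw [add_eq_left, inv_eq_zero] at this
    exact h this

theorem exists_intercept_iff (y₀ y x : ZMod p) : ∃ c, ∀ u : Plane p,
    (toInfinity y₀ u).2 - y * (toInfinity y₀ u).1 = x ↔ intercept (finiteSlope y₀ y) u = c := by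
  rcases eq_or_ne y 0 with rfl | hy
  · refine ⟨x, fun u => ?_⟩
    rw [finiteSlope, if_pos rfl, zero_mul, sub_zero]
    rfl
  · refine ⟨-(x / y), fun u => ?_⟩
    rw [finiteSlope, if_neg hy]
    change u.1 - y * (u.2 - y₀ * u.1) = x ↔ u.2 - (y₀ + y⁻¹) * u.1 = -(x / y)
    constructor
    · rintro rfl; field_simp; ring
    · intro h
      have h1 : x = -(y * (u.2 - (y₀ + y⁻¹) * u.1)) := by rw [h]; field_simp
      rw [h1]; field_simp; ring

theorem CoveredByFinset.of_toInfinity {y₀ : ZMod p}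
    (h : CoveredByFinset (U.map (toInfinity y₀).toEmbedding) n) : CoveredByFinset U n := by
  classical
  obtain ⟨L, h1, h2, h3⟩ := h
  refine ⟨L.image fun ℓ => Finset.univ.filter fun u => toInfinity y₀ u ∈ ℓ,
    Finset.card_image_le.trans h1, ?_, ?_⟩
  · intro ℓ hℓ
    obtain ⟨ℓ', hℓ', rfl⟩ := Finset.mem_image.1 hℓ
    obtain ⟨m, x, rfl⟩ := h2 ℓ' hℓ'
    induction m using OnePoint.rec with
    | infty =>
      refine ⟨(y₀ : Direction p), x, ?_⟩
      ext u
      rw [Finset.mem_filter, mem_line_iff, mem_line_iff]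
      simp only [Finset.mem_univ, true_and]
      rfl
    | coe y =>
      obtain ⟨c, hc⟩ := exists_intercept_iff y₀ y x
      refine ⟨finiteSlope y₀ y, c, ?_⟩
      ext u
      rw [Finset.mem_filter, mem_line_coe, mem_line_iff, hc u]
      simp only [Finset.mem_univ, true_and]
  · intro u hu
    obtain ⟨ℓ, hℓ, hu'⟩ := h3 _ (Finset.mem_map_of_mem _ hu)
    exact ⟨_, Finset.mem_image_of_mem _ hℓ, Finset.mem_filter.2 ⟨Finset.mem_univ _, hu'⟩⟩

theorem CoveredByFinset.coveredByLines (h : CoveredByFinset U n) : CoveredByLines U n := by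
  obtain ⟨L, h1, h2, h3⟩ := h
  refine ⟨fun i => if hi : (i : ℕ) < L.card then (L.equivFin.symm ⟨i, hi⟩ : Finset (Plane p))
    else line OnePoint.infty 0, fun i => ?_, fun u hu => ?_⟩
  · dsimp only
    split_ifs with hi
    · exact h2 _ (L.equivFin.symm ⟨i, hi⟩).2
    · exact ⟨_, _, rfl⟩
  · obtain ⟨ℓ, hℓ, hu'⟩ := h3 u hu
    refine ⟨⟨L.equivFin ⟨ℓ, hℓ⟩, lt_of_lt_of_le (L.equivFin ⟨ℓ, hℓ⟩).2 h1⟩, ?_⟩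
    dsimp only
    rw [dif_pos (L.equivFin ⟨ℓ, hℓ⟩).2]
    simpa using hu'

theorem coveredByFinset_of_ncard (hn : 1 ≤ n) (hU : U.card + r = n * p) (hr : r < p)
    (hN : {m : Direction p | IsSpecial U m}.ncard * (n + 1) + r ≤ p + n + 1) :
    CoveredByFinset U n := by
  classical
  by_cases hex : ∃ y₀ : ZMod p, IsSpecial U (y₀ : Direction p)
  · obtain ⟨y₀, hy₀⟩ := hex
    set S : Finset (ZMod p) := Finset.univ.filter fun y => IsSpecial U (finiteSlope y₀ y) with hS
    -- The slope y₀ sent to infinity is not counted in S; this saving of one turns the bound into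
    -- (n+1)·#S + r ≤ p.
    have hcard : S.card + 1 ≤ {m : Direction p | IsSpecial U m}.ncard := by
      have h1 : (y₀ : Direction p) ∉ S.image (finiteSlope y₀) := by
        intro h
        obtain ⟨y, -, hy⟩ := Finset.mem_image.1 h
        exact finiteSlope_ne y₀ y hy
      rw [← Finset.card_image_of_injective S (finiteSlope_injective y₀),
        ← Finset.card_insert_of_notMem h1, ← Set.ncard_coe_finset]
      refine Set.ncard_le_ncard ?_ (Set.toFinite _)
      intro m hm
      rcases Finset.mem_insert.1 (Finset.mem_coe.1 hm) with rfl | h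
      · exact hy₀
      · obtain ⟨y, hy, rfl⟩ := Finset.mem_image.1 h
        exact (Finset.mem_filter.1 hy).2
    refine CoveredByFinset.of_toInfinity (y₀ := y₀)
      (coveredByFinset_of_slopes (r := r) S hn (by rw [Finset.card_map]; exact hU) ?_ ?_)
    · intro y hy x
      have hy' : ¬ IsSpecial U (finiteSlope y₀ y) := fun h =>
        hy (Finset.mem_filter.2 ⟨Finset.mem_univ _, h⟩)
      obtain ⟨c, hc⟩ := exists_intercept_iff y₀ y x
      have h1 : (abscissae (U.map (toInfinity y₀).toEmbedding) y x).card =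
          (U.filter fun u => intercept (finiteSlope y₀ y) u = c).card := by
        rw [card_abscissae, Finset.filter_map, Finset.card_map]
        congr 1
        exact Finset.filter_congr fun u _ => hc u
      rw [h1]
      exact card_bounds_of_not_isSpecial hU hr hy' c
    · have h1 := Nat.mul_le_mul_right (n + 1) hcard
      rw [add_mul, one_mul] at h1
      rw [mul_comm]
      omega
  -- Only ∞ can be special, so S = ∅ works without a change of coordinates.
  · push Not at hex
    refine coveredByFinset_of_slopes (r := r) ∅ hn hU (fun y _ x => ?_) (by simpa using hr.le)
    rw [card_abscissae]
    exact card_bounds_of_not_isSpecial hU hr (hex y) x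

theorem ceil_le_ncard_isSpecial (hn : 1 ≤ n) (hr : r < p) (hU : (U.card : ℤ) = (n : ℤ) * p - r)
    (hcov : ¬ CoveredByLines U n) : ⌈((p : ℚ) + n + 2 - r) / (n + 1)⌉ ≤
      (({m : Direction p | IsSpecial U m}.ncard : ℕ) : ℤ) := by
  by_contra! h
  refine hcov (coveredByFinset_of_ncard (r := r) hn ?_ hr ?_).coveredByLines
  · have : ((U.card + r : ℕ) : ℤ) = ((n * p : ℕ) : ℤ) := by push_cast; rw [hU]; ring
    exact_mod_cast this
  · rw [Int.lt_ceil, lt_div_iff₀ (by positivity), lt_sub_iff_add_lt] at h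
    have h1 : {m : Direction p | IsSpecial U m}.ncard * (n + 1) + r < p + n + 2 := by
      exact_mod_cast h
    omega

/-- If each line of slope m has at most one point, a rich line forces U to be empty, which is
absurd. A poor line forces #U = p; then every line of slope m has a point and none is poor. -/
theorem IsSpecial.determines (hU : U.card ≤ p) {m : Direction p} (h : IsSpecial U m) :
    Determines U m := by
  classical
  have hp : (0 : ℚ) < p := by exact_mod_cast (Fact.out : p.Prime).pos
  by_contra hdet
  have hinj : Set.InjOn (intercept m) U := by
    intro u hu v hv huv
    by_contra hne
    exact hdet ⟨_, ⟨intercept m v, rfl⟩, u, hu, v, hv, hne, mem_line_iff.2 huv, mem_line_iff.2 rfl⟩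
  obtain ⟨ℓ, ⟨c, rfl⟩, h | h⟩ := h
  · rw [IsRich, card_line_inter] at h
    have h1 : (U.filter fun u => intercept m u = c).card ≤ 1 := by
      rw [Finset.card_le_one]
      intro u hu v hv
      rw [Finset.mem_filter] at hu hv
      exact hinj hu.1 hv.1 (hu.2.trans hv.2.symm)
    have h2 : ((U.filter fun u => intercept m u = c).card : ℚ) ≤ 1 := by exact_mod_cast h1
    have h3 : (U.card : ℚ) / p ≤ 0 := by linarith
    have h4 : U.card = 0 := by
      by_contra h0
      have : (0 : ℚ) < U.card := by exact_mod_cast Nat.pos_of_ne_zero h0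
      exact absurd h3 (not_le.2 (div_pos this hp))
    rw [Finset.card_eq_zero] at h4
    subst h4
    norm_num at h
  · rw [IsPoor, card_line_inter] at h
    have h0 : (0 : ℚ) ≤ ((U.filter fun u => intercept m u = c).card : ℚ) := by positivity
    have h1 : (1 : ℚ) ≤ (U.card : ℚ) / p := by linarith
    rw [le_div_iff₀ hp, one_mul] at h1
    have h2 : U.card = p := le_antisymm hU (by exact_mod_cast h1)
    rw [h2, div_self hp.ne', sub_self] at h
    have h3 : U.image (intercept m) = Finset.univ := by
      rw [← Finset.card_eq_iff_eq_univ, Finset.card_image_of_injOn hinj, h2, ZMod.card]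
    have h4 : c ∈ U.image (intercept m) := h3 ▸ Finset.mem_univ c
    obtain ⟨u, hu, huc⟩ := Finset.mem_image.1 h4
    have h5 : 0 < (U.filter fun u => intercept m u = c).card :=
      Finset.card_pos.2 ⟨u, Finset.mem_filter.2 ⟨hu, huc⟩⟩
    have h6 : (0 : ℚ) < ((U.filter fun u => intercept m u = c).card : ℚ) := by exact_mod_cast h5
    linarith

end Directions

end GaloisPlane

theorem theorem1p3 (p : ℕ) [Fact p.Prime] :
    (∀ (n r : ℕ) (U : Finset (GaloisPlane.Plane p)),
      1 ≤ n → n ≤ p → r < p → (U.card : ℤ) = (n : ℤ) * p - r →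
      ¬ GaloisPlane.CoveredByLines U n →
        ⌈((p : ℚ) + n + 2 - r) / (n + 1)⌉ ≤
          (({m : GaloisPlane.Direction p | GaloisPlane.IsSpecial U m}.ncard : ℕ) : ℤ)) ∧
    (∀ U : Finset (GaloisPlane.Plane p),
      U.card ≤ p → ¬ GaloisPlane.CoveredByLines U 1 →
        ⌈((U.card : ℚ) + 3) / 2⌉ ≤
          (({m : GaloisPlane.Direction p | GaloisPlane.Determines U m}.ncard : ℕ) : ℤ)) := by
  refine ⟨fun n r U hn _ hr hU hcov => GaloisPlane.ceil_le_ncard_isSpecial hn hr hU hcov,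
    fun U hU hcov => ?_⟩
  have h0 : 0 < U.card := by
    refine Nat.pos_of_ne_zero fun h => hcov ?_
    rw [Finset.card_eq_zero] at h
    subst h
    exact ⟨fun _ => GaloisPlane.line OnePoint.infty 0, fun _ => ⟨_, _, rfl⟩, by simp⟩
  have h1 := GaloisPlane.ceil_le_ncard_isSpecial (n := 1) (r := p - U.card) le_rfl (by omega)
    (by push_cast [Nat.cast_sub hU]; ring) hcov
  have h2 : ((p : ℚ) + (1 : ℕ) + 2 - ((p - U.card : ℕ) : ℚ)) / ((1 : ℕ) + 1) =
      ((U.card : ℚ) + 3) / 2 := by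
    push_cast [Nat.cast_sub hU]; ring
  rw [h2] at h1
  refine h1.trans ?_
  exact_mod_cast Set.ncard_le_ncard (fun m hm => GaloisPlane.IsSpecial.determines hU hm)
    (Set.toFinite _)
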